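/- Let $U(x)=-2\log\left(1+\tfrac18|x|^2\right)$ for $x=(x_1,x_2)\in\mathbb R^2$, and set $$\phi_0(x)=\frac{8-|x|^2}{8+|x|^2},\qquad \phi_i(x)=\frac{x_i}{8+|x|^2}\quad (i=1,2),\qquad \phi_3(x)={}_2F_1\!\left(d,1-d;1;\frac{|x|^2}{8+|x|^2}\right),\quad d=\frac{1+i\sqrt7}{2}.$$ Then $\phi_3$ is real valued, smooth, positive and radial, $\phi_3(0)=1$, $-\Delta\phi_3+e^U\phi_3=0$ in $\mathbb R^2$, and as $|x|\to\infty$ $$\phi_3(x)=\frac{e^{\frac{\sqrt7}{2}\pi}+e^{-\frac{\sqrt7}{2}\pi}}{2\pi}\log\left(1+\tfrac18|x|^2\right)+O(1),\qquad \nabla\phi_3(x)=\frac{e^{\frac{\sqrt7}{2}\pi}+e^{-\frac{\sqrt7}{2}\pi}}{\pi}\frac{x}{|x|^2}+o\left(\frac1{|x|}\right).$$ Let $\tau\in[0,1)$, and let $u,v\in C^2(\mathbb R^2)$ be real valued functions such that $$-\Delta u=e^U v,\qquad -\Delta v=e^U u\qquad\text{in }\mathbb R^2,\qquad |u(x)|,\,|v(x)|\le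 C(1+|x|)^\tau\quad\text{for all }x\in\mathbb R^2$$ for some constant $C$. Then there are constants $c_0,c_1,c_2,c_3\in\mathbb R$ with $$(u,v)=\sum_{i=0}^2 c_i(\phi_i,\phi_i)+c_3(\phi_3,-\phi_3).$$ Moreover, the four pairs $(\phi_0,\phi_0),(\phi_1,\phi_1),(\phi_2,\phi_2),(\phi_3,-\phi_3)$ are linearly independent, and for every $\tau\in(0,1)$ the vector space of all such solutions $(u,v)$ (with $C$ depending on the solution) is spanned by them; in particular it has dimension $4$. -/

import Mathlib

open Filter Topology Asymptotics
open scoped ContDiff Laplacian Gradient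

noncomputable section

namespace LaneEmden

/-- The Euclidean plane. -/
abbrev Plane : Type := EuclideanSpace ℝ (Fin 2)

/-- The standard bubble `U(x) = -2 log (1 + |x|² / 8)`, a solution of `-Δ U = e ^ U`. -/
def bubble (x : Plane) : ℝ := -2 * Real.log (1 + (1 / 8) * ‖x‖ ^ 2)

/-- `(u, v)` is a classical solution on the whole plane of
`-Δ u = e ^ U v`, `-Δ v = e ^ U u`, with `|u(x)|, |v(x)| ≤ C (1 + |x|) ^ τ` for some `C`. -/
structure IsLinearizedSolution (τ : ℝ) (u v : Plane → ℝ) : Prop where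
  contDiff_left : ContDiff ℝ 2 u
  contDiff_right : ContDiff ℝ 2 v
  eq_left : ∀ x, -(Δ u) x = Real.exp (bubble x) * v x
  eq_right : ∀ x, -(Δ v) x = Real.exp (bubble x) * u x
  growth : ∃ C : ℝ, ∀ x, |u x| ≤ C * (1 + ‖x‖) ^ τ ∧ |v x| ≤ C * (1 + ‖x‖) ^ τ

/-- The vector space of all solutions `(u, v)` with growth exponent `τ`. -/
def solutionSpace (τ : ℝ) : Submodule ℝ ((Plane → ℝ) × (Plane → ℝ)) where
  carrier := {p | IsLinearizedSolution τ p.1 p.2}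
  zero_mem' := by
    have h0 : (Δ (0 : Plane → ℝ)) = 0 :=
      InnerProductSpace.laplacian_const
    exact ⟨contDiff_const, contDiff_const, fun x => by simp [h0], fun x => by simp [h0],
      0, fun x => by simp⟩
  add_mem' := by
    rintro ⟨u, v⟩ ⟨u', v'⟩ h h'
    obtain ⟨C, hC⟩ := h.growth
    obtain ⟨C', hC'⟩ := h'.growth
    refine ⟨h.contDiff_left.add h'.contDiff_left, h.contDiff_right.add h'.contDiff_right,
      fun x => ?_, fun x => ?_, C + C', fun x => ⟨?_, ?_⟩⟩
    · have e := h.eq_left x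
      have e' := h'.eq_left x
      have l := (h.contDiff_left.contDiffAt (x := x)).laplacian_add h'.contDiff_left.contDiffAt
      simp only [Prod.mk_add_mk, Pi.add_apply] at *
      linarith
    · have e := h.eq_right x
      have e' := h'.eq_right x
      have l := (h.contDiff_right.contDiffAt (x := x)).laplacian_add h'.contDiff_right.contDiffAt
      simp only [Prod.mk_add_mk, Pi.add_apply] at *
      linarith
    · have a := (hC x).1
      have b := (hC' x).1
      have c := abs_add_le (u x) (u' x)
      simp only [Prod.mk_add_mk, Pi.add_apply] at *
      linarith
    · have a := (hC x).2
      have b := (hC' x).2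
      have c := abs_add_le (v x) (v' x)
      simp only [Prod.mk_add_mk, Pi.add_apply] at *
      linarith
  smul_mem' := by
    rintro c ⟨u, v⟩ h
    obtain ⟨C, hC⟩ := h.growth
    refine ⟨h.contDiff_left.const_smul c, h.contDiff_right.const_smul c,
      fun x => ?_, fun x => ?_, |c| * C, fun x => ⟨?_, ?_⟩⟩
    · have e := h.eq_left x
      have l := InnerProductSpace.laplacian_smul c (h.contDiff_left.contDiffAt (x := x))
      simp only [Prod.smul_mk, Pi.smul_apply, smul_eq_mul] at *
      rw [l]
      linear_combination c * e
    · have e := h.eq_right x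
      have l := InnerProductSpace.laplacian_smul c (h.contDiff_right.contDiffAt (x := x))
      simp only [Prod.smul_mk, Pi.smul_apply, smul_eq_mul] at *
      rw [l]
      linear_combination c * e
    · have a := mul_le_mul_of_nonneg_left (hC x).1 (abs_nonneg c)
      simp only [Prod.smul_mk, Pi.smul_apply, smul_eq_mul, abs_mul] at *
      linarith
    · have a := mul_le_mul_of_nonneg_left (hC x).2 (abs_nonneg c)
      simp only [Prod.smul_mk, Pi.smul_apply, smul_eq_mul, abs_mul] at *
      linarith

/-- `φ₀(x) = (8 - |x|²) / (8 + |x|²)`. -/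
def phi0 (x : Plane) : ℝ := (8 - ‖x‖ ^ 2) / (8 + ‖x‖ ^ 2)

/-- `φ₁(x) = x₁ / (8 + |x|²)`. -/
def phi1 (x : Plane) : ℝ := x 0 / (8 + ‖x‖ ^ 2)

/-- `φ₂(x) = x₂ / (8 + |x|²)`. -/
def phi2 (x : Plane) : ℝ := x 1 / (8 + ‖x‖ ^ 2)

/-- The parameter `d = (1 + i √7) / 2` of the hypergeometric function. -/
def hyperParam : ℂ := (1 + Complex.I * (Real.sqrt 7 : ℂ)) / 2

/-- The four pairs `(φ₀, φ₀)`, `(φ₁, φ₁)`, `(φ₂, φ₂)`, `(φ₃, -φ₃)`. -/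
def basisPair (phi3 : Plane → ℝ) : Fin 4 → (Plane → ℝ) × (Plane → ℝ) :=
  ![(phi0, phi0), (phi1, phi1), (phi2, phi2), (phi3, -phi3)]

/-- The constant `(e ^ (√7 π / 2) + e ^ (-√7 π / 2)) / (2 π)`. -/
def logCoeff : ℝ :=
  (Real.exp (Real.sqrt 7 / 2 * Real.pi) + Real.exp (-(Real.sqrt 7 / 2 * Real.pi)))
    / (2 * Real.pi)

end LaneEmden

end

/-! The sum w = u + v satisfies Δw = -e^U w and the difference w = u - v satisfies Δw = e^U w, so
the system splits into two scalar equations. On circles |x| = r, integrating w against cos kθ or sin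
kθ gives a mode m with r (r m')' = (k² ± 64 r² / (8 + r²)²) m, regular at the origin.

For the low frequencies (k = 0, 1 for the sum, k = 0 for the difference) an explicit regular
solution p is known. The Wronskian r (p m' - p' m) is constant and vanishes at r = 0, so m is a
multiple of p (`IsRadialSolution.exists_eq_mul`) and is determined by its data at 0. For the other
frequencies the coefficient is at least 1, and an energy argument makes m² grow quadratically unless
m = 0 (`IsRadialSolution.eq_zero_of_growth`); this contradicts τ < 1. Hence w = 0 once w(0) = 0 and,
for the sum, ∇w(0) = 0, because all Fourier coefficients on every circle vanish
(`eq_zero_of_modes_eq_zero`). Subtracting the combination of the four pairs with the same data at 0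
proves the classification.

For φ₃, d (1 - d) = 2 makes the Taylor coefficients a_n real and positive. The sequence n a_n
increases to sin(πd)/π, by Euler's limit for Γ and the reflection formula
(`tendsto_mul_hyperCoeff`), with error O(1/n). Comparison with the series of -log(1 - z) gives the
logarithm, and Abel's theorem for (1 - z) F' gives the gradient. -/

noncomputable section

namespace LaneEmden

/-! ### Real power series with coefficients of polynomial growth -/

/-- The sum of the real power series with coefficients `c`. -/
def powerSum (c : ℕ → ℝ) (z : ℝ) : ℝ := ∑' n, c n * z ^ n

/-- The coefficients of the derived power series. -/
def derivCoeff (c : ℕ → ℝ) (n : ℕ) : ℝ := (n + 1) * c (n + 1)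

/-- Polynomial growth of a sequence of coefficients. -/
def PolyGrowth (c : ℕ → ℝ) : Prop := ∃ (M : ℝ) (k : ℕ), ∀ n : ℕ, |c n| ≤ M * ((n : ℝ) + 1) ^ k

theorem summable_add_one_pow_mul_geometric (k : ℕ) {z : ℝ} (hz : |z| < 1) :
    Summable fun n : ℕ => ((n : ℝ) + 1) ^ k * |z| ^ n := by
  rcases eq_or_ne z 0 with rfl | h0
  · refine summable_of_ne_finset_zero (s := {0}) fun n hn => ?_
    have : n ≠ 0 := by simpa using hn
    simp [this]
  have h := (summable_pow_mul_geometric_of_norm_lt_one (R := ℝ) k (r := |z|) (by simpa using hz))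
  have h1 := ((summable_nat_add_iff 1).2 h).mul_right (|z|⁻¹)
  refine h1.congr fun n => ?_
  have : |z| ≠ 0 := abs_ne_zero.2 h0
  push_cast
  rw [pow_succ]
  field_simp

theorem PolyGrowth.summable_abs {c : ℕ → ℝ} (hc : PolyGrowth c) {z : ℝ} (hz : |z| < 1) :
    Summable fun n : ℕ => |c n| * |z| ^ n := by
  obtain ⟨M, k, h⟩ := hc
  refine Summable.of_nonneg_of_le (fun n => by positivity) (fun n => ?_)
    ((summable_add_one_pow_mul_geometric k hz).mul_left M)
  rw [← mul_assoc]
  exact mul_le_mul_of_nonneg_right (h n) (by positivity)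

theorem PolyGrowth.summable {c : ℕ → ℝ} (hc : PolyGrowth c) {z : ℝ} (hz : |z| < 1) :
    Summable fun n : ℕ => c n * z ^ n := by
  refine Summable.of_norm ?_
  simpa [abs_mul, abs_pow] using hc.summable_abs hz

theorem PolyGrowth.derivCoeff {c : ℕ → ℝ} (hc : PolyGrowth c) : PolyGrowth (derivCoeff c) := by
  obtain ⟨M, k, h⟩ := hc
  have hM : 0 ≤ M := by simpa using (abs_nonneg _).trans (h 0)
  refine ⟨M * 2 ^ k, k + 1, fun n => ?_⟩
  have h1 := h (n + 1)
  push_cast at h1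
  rw [LaneEmden.derivCoeff, abs_mul, abs_of_nonneg (by positivity : (0 : ℝ) ≤ n + 1)]
  have h2 : ((n : ℝ) + 1 + 1) ^ k ≤ (2 * ((n : ℝ) + 1)) ^ k := by
    gcongr
    have : (0 : ℝ) ≤ n := n.cast_nonneg
    linarith
  calc ((n : ℝ) + 1) * |c (n + 1)| ≤ (n + 1) * (M * (2 * ((n : ℝ) + 1)) ^ k) := by gcongr; exact h1.trans (by gcongr)
    _ = M * 2 ^ k * (n + 1) ^ (k + 1) := by rw [mul_pow, pow_succ]; ring

/-- Termwise differentiation on (-ρ, ρ) with |z| < ρ < 1, dominated by the derived series at ρ.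
Polynomial growth survives derivation, so this can be iterated. -/
theorem PolyGrowth.hasDerivAt {c : ℕ → ℝ} (hc : PolyGrowth c) {z : ℝ} (hz : |z| < 1) :
    HasDerivAt (powerSum c) (powerSum (LaneEmden.derivCoeff c) z) z := by
  obtain ⟨ρ, h1, h2⟩ := exists_between hz
  have hρ : 0 < ρ := (abs_nonneg z).trans_lt h1
  have hρ' : |ρ| < 1 := by rwa [abs_of_pos hρ]
  have hsum : Summable fun n : ℕ => |c n| * (n * ρ ^ (n - 1)) := by
    rw [← summable_nat_add_iff 1]
    refine (hc.derivCoeff.summable_abs hρ').congr fun n => ?_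
    rw [LaneEmden.derivCoeff, abs_mul, abs_of_nonneg (by positivity : (0 : ℝ) ≤ n + 1), abs_of_pos hρ]
    rw [Nat.add_sub_cancel]
    push_cast
    ring
  have key := hasDerivAt_tsum_of_isPreconnected (t := Set.Ioo (-ρ) ρ) (y₀ := 0) (y := z)
    (g := fun n y => c n * y ^ n) (g' := fun n y => c n * (n * y ^ (n - 1))) hsum isOpen_Ioo
    isPreconnected_Ioo (fun n y _ => (hasDerivAt_pow n y).const_mul (c n)) (fun n y hy => ?_)
    ⟨by linarith, hρ⟩ (hc.summable (by simp)) (abs_lt.1 h1)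
  · have hs' : Summable fun n : ℕ => c n * (n * z ^ (n - 1)) := by
      refine Summable.of_norm_bounded hsum fun n => ?_
      rw [Real.norm_eq_abs, abs_mul, abs_mul, abs_pow, Nat.abs_cast]
      gcongr
    convert! key using 1
    rw [hs'.tsum_eq_zero_add, powerSum]
    simp only [Nat.cast_zero, zero_mul, mul_zero, zero_add]
    refine tsum_congr fun n => ?_
    rw [LaneEmden.derivCoeff]
    rw [Nat.add_sub_cancel]
    push_cast
    ring
  · have : |y| ≤ ρ := (abs_lt.2 hy).le
    rw [Real.norm_eq_abs, abs_mul, abs_mul, abs_pow, Nat.abs_cast]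
    gcongr

theorem PolyGrowth.contDiffOn {c : ℕ → ℝ} (hc : PolyGrowth c) :
    ContDiffOn ℝ ∞ (powerSum c) (Set.Ioo (-1) 1) := by
  rw [contDiffOn_infty]
  intro n
  induction n generalizing c with
  | zero =>
    exact contDiffOn_zero.2 fun z hz =>
      (hc.hasDerivAt (abs_lt.2 hz)).continuousAt.continuousWithinAt
  | succ n ih =>
    push_cast
    rw [contDiffOn_succ_iff_deriv_of_isOpen isOpen_Ioo]
    refine ⟨fun z hz => (hc.hasDerivAt (abs_lt.2 hz)).differentiableAt.differentiableWithinAt,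
      by simp, ?_⟩
    exact (ih hc.derivCoeff).congr fun z hz => (hc.hasDerivAt (abs_lt.2 hz)).deriv

/-! ### The hypergeometric coefficients -/

/-- The Taylor coefficients of `₂F₁(d, 1 - d; 1; z)`, using `d (1 - d) = 2`. -/
def hyperCoeff (n : ℕ) : ℝ := ∏ j ∈ Finset.range n, ((j : ℝ) ^ 2 + j + 2) / ((j : ℝ) + 1) ^ 2

theorem hyperCoeff_pos (n : ℕ) : 0 < hyperCoeff n :=
  Finset.prod_pos fun j _ => by positivity

@[simp] theorem hyperCoeff_zero : hyperCoeff 0 = 1 := by simp [hyperCoeff]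

theorem hyperCoeff_succ (n : ℕ) :
    hyperCoeff (n + 1) = hyperCoeff n * (((n : ℝ) ^ 2 + n + 2) / ((n : ℝ) + 1) ^ 2) := by
  rw [hyperCoeff, Finset.prod_range_succ, ← hyperCoeff]

/-- Since n² + n + 2 - n (n + 1) = 2. These increments of n a_n are positive and are also the
coefficients of (1 - z) F', so they govern both the limit of n a_n and the behaviour of F' at 1. -/
theorem succ_mul_hyperCoeff_succ (n : ℕ) :
    ((n : ℝ) + 1) * hyperCoeff (n + 1) - n * hyperCoeff n = 2 * hyperCoeff n / (n + 1) := by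
  rw [hyperCoeff_succ]
  field_simp
  ring

theorem hyperParam_mul : hyperParam * (1 - hyperParam) = 2 := by
  have h : ((Real.sqrt 7 : ℝ) : ℂ) ^ 2 = 7 := by
    rw [← Complex.ofReal_pow, Real.sq_sqrt (by norm_num)]; norm_num
  rw [hyperParam]
  linear_combination (-(1 : ℂ) / 4) * Complex.I ^ 2 * h + (-(7 : ℂ) / 4) * Complex.I_sq

theorem prod_hyperParam (n : ℕ) :
    (∏ j ∈ Finset.range n, (hyperParam + j)) * ∏ j ∈ Finset.range n, (1 - hyperParam + (j : ℂ))
      = (hyperCoeff n * (n.factorial : ℝ) ^ 2 : ℝ) := by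
  induction n with
  | zero => simp
  | succ n ih =>
    rw [Finset.prod_range_succ, Finset.prod_range_succ, hyperCoeff_succ, Nat.factorial_succ]
    have hne : ((n : ℂ) + 1) ≠ 0 := by exact_mod_cast n.succ_ne_zero
    have e : (hyperParam + n) * (1 - hyperParam + n) = (n : ℂ) ^ 2 + n + 2 := by
      linear_combination hyperParam_mul
    calc _ = ((∏ j ∈ Finset.range n, (hyperParam + j)) *
          ∏ j ∈ Finset.range n, (1 - hyperParam + (j : ℂ))) *
          ((hyperParam + n) * (1 - hyperParam + n)) := by ring
      _ = _ := by
        rw [ih, e]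
        push_cast
        field_simp

theorem ascPochhammer_eval_eq_prod_range' (n : ℕ) (s : ℂ) :
    (ascPochhammer ℂ n).eval s = ∏ j ∈ Finset.range n, (s + j) := by
  induction n with
  | zero => simp
  | succ n ih => rw [ascPochhammer_succ_eval, ih, Finset.prod_range_succ]

theorem ordinaryHypergeometric_hyperParam (z : ℝ) :
    ordinaryHypergeometric hyperParam (1 - hyperParam) (1 : ℂ) (z : ℂ)
      = (powerSum hyperCoeff z : ℂ) := by
  rw [ordinaryHypergeometric_eq_tsum, powerSum, Complex.ofReal_tsum]
  refine tsum_congr fun n => ?_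
  have h := prod_hyperParam n
  have hf : (n.factorial : ℂ) ≠ 0 := by exact_mod_cast n.factorial_ne_zero
  rw [mul_assoc (_⁻¹), ascPochhammer_eval_eq_prod_range', ascPochhammer_eval_eq_prod_range', h,
    ascPochhammer_eval_one, smul_eq_mul]
  push_cast
  field_simp

/-! ### Asymptotics of the coefficients through the Gamma function -/

theorem sin_pi_mul_hyperParam : Complex.sin (Real.pi * hyperParam) / Real.pi = (logCoeff : ℂ) := by
  have e : (Real.pi : ℂ) * hyperParam
      = ((Real.sqrt 7 / 2 * Real.pi : ℝ) : ℂ) * Complex.I + Real.pi / 2 := by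
    rw [hyperParam]; push_cast; ring
  rw [e, Complex.sin_add_pi_div_two, Complex.cos_mul_I, logCoeff, ← Complex.ofReal_cosh,
    Real.cosh_eq]
  push_cast
  field_simp

/-- The powers combine to n^d n^(1-d) = n. The denominators run over j ≤ n, hence the index n + 1.
-/
theorem GammaSeq_mul_GammaSeq_hyperParam {n : ℕ} (hn : n ≠ 0) :
    Complex.GammaSeq hyperParam n * Complex.GammaSeq (1 - hyperParam) n
      = (n / (((n : ℝ) + 1) ^ 2 * hyperCoeff (n + 1)) : ℝ) := by
  have hn' : (n : ℂ) ≠ 0 := by exact_mod_cast hn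
  have hf : (n.factorial : ℂ) ≠ 0 := by exact_mod_cast n.factorial_ne_zero
  have ha : (hyperCoeff (n + 1) : ℂ) ≠ 0 := by exact_mod_cast (hyperCoeff_pos (n + 1)).ne'
  have h1 : ((n : ℂ) + 1) ≠ 0 := by exact_mod_cast n.succ_ne_zero
  have hp : (n : ℂ) ^ hyperParam * (n : ℂ) ^ (1 - hyperParam) = n := by
    rw [← Complex.cpow_add _ _ hn']; simp
  rw [Complex.GammaSeq, Complex.GammaSeq, div_mul_div_comm, prod_hyperParam, Nat.factorial_succ]
  have : (n : ℂ) ^ hyperParam * n.factorial * ((n : ℂ) ^ (1 - hyperParam) * n.factorial)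
      = n * (n.factorial : ℂ) ^ 2 := by linear_combination (n.factorial : ℂ) ^ 2 * hp
  rw [this]
  push_cast
  field_simp

theorem logCoeff_pos : 0 < logCoeff := by
  unfold logCoeff
  have := Real.pi_pos
  positivity

theorem tendsto_mul_hyperCoeff :
    Tendsto (fun n : ℕ => (n : ℝ) * hyperCoeff n) atTop (𝓝 logCoeff) := by
  rw [← tendsto_add_atTop_iff_nat 1]
  have h := (Complex.GammaSeq_tendsto_Gamma hyperParam).mul
    (Complex.GammaSeq_tendsto_Gamma (1 - hyperParam))
  rw [Complex.Gamma_mul_Gamma_one_sub, ← inv_div, sin_pi_mul_hyperParam, ← Complex.ofReal_inv] at h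
  have h2 : Tendsto (fun n : ℕ => (n : ℝ) / (((n : ℝ) + 1) ^ 2 * hyperCoeff (n + 1))) atTop
      (𝓝 logCoeff⁻¹) := by
    have h3 := (Complex.continuous_re.tendsto _).comp h
    rw [Complex.ofReal_re] at h3
    refine h3.congr' ?_
    filter_upwards [eventually_ne_atTop 0] with n hn
    rw [Function.comp_apply, GammaSeq_mul_GammaSeq_hyperParam hn, Complex.ofReal_re]
  have h4 := (h2.inv₀ (inv_ne_zero logCoeff_pos.ne')).mul
    (tendsto_natCast_div_add_atTop (1 : ℝ))
  rw [inv_inv, mul_one] at h4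
  refine h4.congr' ?_
  filter_upwards [eventually_ne_atTop 0] with n hn
  have hn' : (n : ℝ) ≠ 0 := by exact_mod_cast hn
  have ha := (hyperCoeff_pos (n + 1)).ne'
  push_cast
  field_simp

theorem monotone_mul_hyperCoeff : Monotone fun n : ℕ => (n : ℝ) * hyperCoeff n := by
  refine monotone_nat_of_le_succ fun n => ?_
  have h := succ_mul_hyperCoeff_succ n
  have : 0 ≤ 2 * hyperCoeff n / (n + 1) := by have := hyperCoeff_pos n; positivity
  push_cast
  linarith

theorem mul_hyperCoeff_le (n : ℕ) : (n : ℝ) * hyperCoeff n ≤ logCoeff :=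
  monotone_mul_hyperCoeff.ge_of_tendsto tendsto_mul_hyperCoeff n

/-- The right side decreases to `logCoeff`: since k a_k ≤ `logCoeff`, each increment of n a_n is at
most the telescoping decrease of 2 `logCoeff` / (n + 1). This rate makes the comparison with the
logarithm summable. -/
theorem logCoeff_le (n : ℕ) :
    logCoeff ≤ ((n : ℝ) + 1) * hyperCoeff (n + 1) + 2 * logCoeff / (n + 1) := by
  have hanti : Antitone fun n : ℕ =>
      ((n : ℝ) + 1) * hyperCoeff (n + 1) + 2 * logCoeff / (n + 1) := by
    refine antitone_nat_of_succ_le fun n => ?_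
    have h := succ_mul_hyperCoeff_succ (n + 1)
    have h1 := mul_hyperCoeff_le (n + 1)
    push_cast at h h1 ⊢
    have h2 : 2 * hyperCoeff (n + 1) / ((n : ℝ) + 1 + 1)
        ≤ 2 * logCoeff / (n + 1) - 2 * logCoeff / (n + 1 + 1) := by
      rw [div_sub_div _ _ (by positivity) (by positivity), div_le_div_iff₀ (by positivity)
        (by positivity)]
      have : 0 ≤ (n : ℝ) + 1 + 1 := by positivity
      nlinarith [mul_le_mul_of_nonneg_left h1 this]
    linarith
  have hb := (tendsto_add_atTop_iff_nat 1).2 tendsto_mul_hyperCoeff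
  have h0 : Tendsto (fun n : ℕ => 2 * logCoeff / ((n : ℝ) + 1)) atTop (𝓝 0) := by
    have := (tendsto_one_div_add_atTop_nhds_zero_nat (𝕜 := ℝ)).const_mul (2 * logCoeff)
    simpa [div_eq_mul_inv] using this
  have ht := hb.add h0
  rw [add_zero] at ht
  push_cast at ht
  exact hanti.le_of_tendsto ht n

theorem polyGrowth_hyperCoeff : PolyGrowth hyperCoeff := by
  refine ⟨logCoeff + 1, 0, fun n => ?_⟩
  have hL := logCoeff_pos
  rw [abs_of_pos (hyperCoeff_pos n), pow_zero, mul_one]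
  rcases n with _ | n
  · simp [hL.le]
  · have h := mul_hyperCoeff_le (n + 1)
    have h1 := hyperCoeff_pos (n + 1)
    push_cast at h
    nlinarith [(n.cast_nonneg : (0 : ℝ) ≤ n)]

/-! ### The hypergeometric function -/

/-- The real function `₂F₁(d, 1 - d; 1; z)`. -/
def hyperFun : ℝ → ℝ := powerSum hyperCoeff

/-- The first derivative of `hyperFun`. -/
def hyperFun' : ℝ → ℝ := powerSum (derivCoeff hyperCoeff)

/-- The second derivative of `hyperFun`. -/
def hyperFun'' : ℝ → ℝ := powerSum (derivCoeff (derivCoeff hyperCoeff))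

theorem hasDerivAt_hyperFun {z : ℝ} (hz : |z| < 1) : HasDerivAt hyperFun (hyperFun' z) z :=
  polyGrowth_hyperCoeff.hasDerivAt hz

theorem hasDerivAt_hyperFun' {z : ℝ} (hz : |z| < 1) : HasDerivAt hyperFun' (hyperFun'' z) z :=
  polyGrowth_hyperCoeff.derivCoeff.hasDerivAt hz

@[simp] theorem hyperFun_zero : hyperFun 0 = 1 := by
  rw [hyperFun, powerSum, tsum_eq_single 0 (fun n hn => by simp [hn])]
  simp

theorem hyperFun_pos {z : ℝ} (h0 : 0 ≤ z) (h1 : z < 1) : 0 < hyperFun z := by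
  have hs := polyGrowth_hyperCoeff.summable (z := z) (by rwa [abs_of_nonneg h0])
  refine hs.tsum_pos (fun n => mul_nonneg (hyperCoeff_pos n).le (by positivity)) 0 ?_
  simp

/-- The coefficients of `(1 - z) hyperFun' z`. -/
def hyperDiff (n : ℕ) : ℝ := 2 * hyperCoeff n / (n + 1)

theorem one_sub_mul_hyperFun' {z : ℝ} (hz : |z| < 1) :
    (1 - z) * hyperFun' z = ∑' n, hyperDiff n * z ^ n := by
  have hs := polyGrowth_hyperCoeff.derivCoeff.summable hz
  have hs' : Summable fun n : ℕ => (n : ℝ) * hyperCoeff n * z ^ n := by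
    rw [← summable_nat_add_iff 1]
    refine (hs.mul_left z).congr fun n => ?_
    rw [derivCoeff]
    push_cast
    ring
  have e : z * hyperFun' z = ∑' n : ℕ, (n : ℝ) * hyperCoeff n * z ^ n := by
    rw [hs'.tsum_eq_zero_add, hyperFun', powerSum, ← tsum_mul_left]
    simp only [Nat.cast_zero, zero_mul, zero_add]
    refine tsum_congr fun n => ?_
    rw [derivCoeff]
    push_cast
    ring
  rw [sub_mul, one_mul, e, hyperFun', powerSum, ← hs.tsum_sub hs']
  refine tsum_congr fun n => ?_
  rw [derivCoeff, hyperDiff, ← succ_mul_hyperCoeff_succ]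
  ring

/-- Abel's limit theorem: the partial sums of the coefficients of (1 - z) F' telescope to n a_n. -/
theorem tendsto_one_sub_mul_hyperFun' :
    Tendsto (fun z => (1 - z) * hyperFun' z) (𝓝[<] 1) (𝓝 logCoeff) := by
  have h : Tendsto (fun n => ∑ i ∈ Finset.range n, hyperDiff i) atTop (𝓝 logCoeff) := by
    refine tendsto_mul_hyperCoeff.congr fun n => ?_
    have := Finset.sum_range_sub (fun n : ℕ => (n : ℝ) * hyperCoeff n) n
    simp only [Nat.cast_zero, zero_mul, sub_zero] at this
    rw [← this]
    refine Finset.sum_congr rfl fun i _ => ?_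
    rw [hyperDiff, ← succ_mul_hyperCoeff_succ]
    push_cast
    rfl
  refine (Real.tendsto_tsum_powerSeries_nhdsWithin_lt h).congr' ?_
  filter_upwards [Ioo_mem_nhdsLT (show (0 : ℝ) < 1 by norm_num)] with z hz
  exact (one_sub_mul_hyperFun' (by rw [abs_of_pos hz.1]; exact hz.2)).symm

/-- This is the divergence form (z (1 - z) F')' = 2 F expanded; the coefficients of z (1 - z) F' are
2 a_(n-1) / n. -/
theorem hyperFun_ode {z : ℝ} (hz : |z| < 1) :
    z * (1 - z) * hyperFun'' z + (1 - 2 * z) * hyperFun' z = 2 * hyperFun z := by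
  -- At n = 0 division by zero gives 0, the correct constant term.
  have hp : PolyGrowth fun n : ℕ => 2 * hyperCoeff (n - 1) / n := by
    obtain ⟨M, k, h⟩ := polyGrowth_hyperCoeff
    have hM : 0 ≤ M := by simpa using (abs_nonneg _).trans (h 0)
    refine ⟨2 * M, k, fun n => ?_⟩
    rcases n with _ | n
    · simpa using hM
    have h1 := h n
    beta_reduce
    rw [Nat.add_sub_cancel, abs_div, abs_mul, abs_two, Nat.abs_cast]
    push_cast
    rw [div_le_iff₀ (by positivity)]
    have h2 : ((n : ℝ) + 1) ^ k ≤ (n + 1 + 1) ^ k := by gcongr; linarith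
    have h3 : M * ((n : ℝ) + 1) ^ k ≤ M * (n + 1 + 1) ^ k := by gcongr
    have h4 : 0 ≤ M * ((n : ℝ) + 1 + 1) ^ k := by positivity
    nlinarith [(n.cast_nonneg : (0 : ℝ) ≤ n)]
  have e : ∀ y : ℝ, |y| < 1 →
      powerSum (fun n : ℕ => 2 * hyperCoeff (n - 1) / n) y = y * (1 - y) * hyperFun' y := by
    intro y hy
    rw [mul_assoc, one_sub_mul_hyperFun' hy, powerSum, (hp.summable hy).tsum_eq_zero_add,
      ← tsum_mul_left]
    simp only [Nat.cast_zero, div_zero, zero_mul, zero_add]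
    refine tsum_congr fun n => ?_
    rw [hyperDiff, Nat.add_sub_cancel]
    push_cast
    ring
  have h1 := hp.hasDerivAt hz
  have e2 : powerSum (derivCoeff fun n : ℕ => 2 * hyperCoeff (n - 1) / n) z = 2 * hyperFun z := by
    rw [powerSum, hyperFun, powerSum, ← tsum_mul_left]
    refine tsum_congr fun n => ?_
    rw [derivCoeff, Nat.add_sub_cancel]
    push_cast
    field_simp
  rw [e2] at h1
  have h2 : HasDerivAt (fun y => y * (1 - y) * hyperFun' y)
      ((1 * (1 - z) + z * (0 - 1)) * hyperFun' z + z * (1 - z) * hyperFun'' z) z :=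
    ((hasDerivAt_id z).mul ((hasDerivAt_const z 1).sub (hasDerivAt_id z))).mul
      (hasDerivAt_hyperFun' hz)
  have h3 := h2.unique (h1.congr_of_eventuallyEq ?_)
  · linarith
  · have : ∀ᶠ y in 𝓝 z, |y| < 1 := continuous_abs.continuousAt.eventually_lt_const hz
    filter_upwards [this] with y hy
    exact (e y hy).symm

/-- `hyperFun` differs from `-logCoeff * log (1 - z)` by a bounded function. -/
theorem exists_hyperFun_add_log_bound :
    ∃ K : ℝ, ∀ z : ℝ, 0 ≤ z → z < 1 → |hyperFun z + logCoeff * Real.log (1 - z)| ≤ K := by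
  have hsum : Summable fun n : ℕ => 2 * logCoeff / ((n : ℝ) + 1) ^ 2 := by
    have h := (summable_nat_add_iff 1).2 (Real.summable_one_div_nat_pow.2 one_lt_two)
    refine (h.mul_left (2 * logCoeff)).congr fun n => ?_
    push_cast
    ring
  refine ⟨1 + ∑' n : ℕ, 2 * logCoeff / ((n : ℝ) + 1) ^ 2, fun z h0 h1 => ?_⟩
  have hz : |z| < 1 := by rwa [abs_of_nonneg h0]
  have hlog := (Real.hasSum_pow_div_log_of_abs_lt_one hz).mul_left logCoeff
  have hs := polyGrowth_hyperCoeff.summable hz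
  have hs1 := (summable_nat_add_iff 1).2 hs
  have e : hyperFun z + logCoeff * Real.log (1 - z)
      = 1 + ∑' n : ℕ, (hyperCoeff (n + 1) * z ^ (n + 1) - logCoeff * (z ^ (n + 1) / (n + 1))) := by
    rw [hs1.tsum_sub hlog.summable, hlog.tsum_eq, hyperFun, powerSum, hs.tsum_eq_zero_add]
    simp
    ring
  rw [e]
  refine (abs_add_le _ _).trans ?_
  rw [abs_one]
  gcongr
  rw [← Real.norm_eq_abs]
  refine tsum_of_norm_bounded hsum.hasSum fun n => ?_
  have hn : (0 : ℝ) < n + 1 := by positivity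
  have hle := mul_hyperCoeff_le (n + 1)
  have hge := logCoeff_le n
  push_cast at hle
  -- The bracket is O(1/n) by `logCoeff_le`, so the terms are O(1/n²) uniformly in z.
  have ef : hyperCoeff (n + 1) * z ^ (n + 1) - logCoeff * (z ^ (n + 1) / (n + 1))
      = (((n : ℝ) + 1) * hyperCoeff (n + 1) - logCoeff) / (n + 1) * z ^ (n + 1) := by
    field_simp
  have hpow : |z ^ (n + 1)| ≤ 1 := by rw [abs_pow]; exact pow_le_one₀ (abs_nonneg z) hz.le
  rw [Real.norm_eq_abs, ef, abs_mul, abs_div, abs_of_pos hn]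
  have h3 : |((n : ℝ) + 1) * hyperCoeff (n + 1) - logCoeff| ≤ 2 * logCoeff / (n + 1) := by
    rw [abs_le]; constructor
    · linarith
    · have : 0 ≤ 2 * logCoeff / ((n : ℝ) + 1) := by have := logCoeff_pos; positivity
      linarith
  have hL := logCoeff_pos
  calc _ ≤ 2 * logCoeff / (n + 1) / (n + 1) * 1 := by gcongr
    _ = _ := by field_simp

/-! ### Second derivatives on the plane -/

theorem laplacian_eq_fderiv_fderiv (f : Plane → ℝ) (x : Plane) :
    (Δ f) x = ∑ i, fderiv ℝ (fderiv ℝ f) x (EuclideanSpace.single i 1) (EuclideanSpace.single i 1) := by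
  rw [InnerProductSpace.laplacian_eq_iteratedFDeriv_orthonormalBasis f
    (EuclideanSpace.basisFun (Fin 2) ℝ)]
  simp [iteratedFDeriv_two_apply]

theorem differentiable_fderiv_of_contDiff_two {f : Plane → ℝ} (hf : ContDiff ℝ 2 f) :
    Differentiable ℝ (fderiv ℝ f) :=
  (hf.fderiv_right (m := 1) (by norm_num)).differentiable (by norm_num)

theorem fderiv_fderiv_eq_of_hasDerivAt_line {f g : Plane → ℝ} (hf : ContDiff ℝ 2 f) {x v : Plane}
    {c : ℝ} (h1 : ∀ y, HasDerivAt (fun t : ℝ => f (y + t • v)) (g y) 0)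
    (h2 : HasDerivAt (fun t : ℝ => g (x + t • v)) c 0) :
    fderiv ℝ (fderiv ℝ f) x v v = c := by
  have hg : g = fun y => fderiv ℝ f y v := by
    funext y
    have hd := ((hf.differentiable (by norm_num)) y).hasFDerivAt.hasLineDerivAt v
    exact (h1 y).unique hd
  have hd := (((differentiable_fderiv_of_contDiff_two hf) x).hasFDerivAt.clm_apply
    (hasFDerivAt_const v x)).hasLineDerivAt v
  rw [hg] at h2
  have := h2.unique hd
  simpa using this.symm

theorem hasDerivAt_norm_sq_line (y v : Plane) :
    HasDerivAt (fun t : ℝ => ‖y + t • v‖ ^ 2) (2 * inner ℝ y v) 0 := by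
  have h := ((hasStrictFDerivAt_norm_sq y).hasFDerivAt (𝕜 := ℝ)).hasLineDerivAt v
  simpa [HasLineDerivAt] using h

/-- One computation for all four functions: α = 1, ℓ = 0 for φ₀ and φ₃, and α = 0, ℓ a coordinate
for φ₁ and φ₂. Using |x|² as the radial variable avoids any singularity at 0. -/
theorem laplacian_radial_mul_affine {G G' G'' : ℝ → ℝ} {α : ℝ} {ℓ : Plane →L[ℝ] ℝ}
    {f : Plane → ℝ} (hf : ContDiff ℝ 2 f) (hfG : ∀ x, f x = G (‖x‖ ^ 2) * (α + ℓ x))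
    (h1 : ∀ s, 0 ≤ s → HasDerivAt G (G' s) s) (h2 : ∀ s, 0 ≤ s → HasDerivAt G' (G'' s) s)
    (x : Plane) :
    (Δ f) x = (4 * ‖x‖ ^ 2 * G'' (‖x‖ ^ 2) + 4 * G' (‖x‖ ^ 2)) * (α + ℓ x)
      + 4 * G' (‖x‖ ^ 2) * ℓ x := by
  have haff : ∀ y v : Plane, HasDerivAt (fun t : ℝ => α + ℓ (y + t • v)) (ℓ v) 0 := by
    intro y v
    have h := (ℓ.hasFDerivAt (x := y)).hasLineDerivAt v
    exact HasDerivAt.const_add α h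
  have hcomp : ∀ {H H' : ℝ → ℝ}, (∀ s, 0 ≤ s → HasDerivAt H (H' s) s) → ∀ y v : Plane,
      HasDerivAt (fun t : ℝ => H (‖y + t • v‖ ^ 2)) (H' (‖y‖ ^ 2) * (2 * inner ℝ y v)) 0 := by
    intro H H' h y v
    have := (h (‖y + (0 : ℝ) • v‖ ^ 2) (by positivity)).comp (0 : ℝ) (hasDerivAt_norm_sq_line y v)
    simpa [Function.comp_def] using this
  have key : ∀ v : Plane, fderiv ℝ (fderiv ℝ f) x v v =
      4 * G'' (‖x‖ ^ 2) * inner ℝ x v ^ 2 * (α + ℓ x) + 4 * G' (‖x‖ ^ 2) * inner ℝ x v * ℓ v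
        + 2 * G' (‖x‖ ^ 2) * (α + ℓ x) * ‖v‖ ^ 2 := by
    intro v
    refine fderiv_fderiv_eq_of_hasDerivAt_line
      (g := fun y => G' (‖y‖ ^ 2) * (2 * inner ℝ y v) * (α + ℓ y) + G (‖y‖ ^ 2) * ℓ v) hf ?_ ?_
    · intro y
      simp_rw [hfG]
      convert! (hcomp h1 y v).mul (haff y v) using 1
      simp
    · have hin : HasDerivAt (fun t : ℝ => 2 * inner ℝ (x + t • v) v) (2 * ‖v‖ ^ 2) 0 := by
        have e : (fun t : ℝ => 2 * inner ℝ (x + t • v) v)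
            = fun t => 2 * (inner ℝ x v + t * ‖v‖ ^ 2) := by
          funext t
          rw [inner_add_left, real_inner_smul_left, real_inner_self_eq_norm_sq]
        rw [e]
        simpa using (((hasDerivAt_id (0 : ℝ)).mul_const (‖v‖ ^ 2)).const_add
          (inner ℝ x v)).const_mul 2
      have := (((hcomp h2 x v).mul hin).mul (haff x v)).add ((hcomp h1 x v).mul_const (ℓ v))
      convert! this using 1
      simp
      ring
  have hx : ℓ x = x 0 * ℓ (EuclideanSpace.single 0 1) + x 1 * ℓ (EuclideanSpace.single 1 1) := by
    have : x = x 0 • EuclideanSpace.single 0 1 + x 1 • EuclideanSpace.single 1 1 := by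
      ext i; fin_cases i <;> simp
    conv_lhs => rw [this]
    simp
  have hn : ‖x‖ ^ 2 = x 0 ^ 2 + x 1 ^ 2 := by
    rw [EuclideanSpace.norm_sq_eq]; simp
  rw [laplacian_eq_fderiv_fderiv]
  simp only [key, Fin.sum_univ_two, EuclideanSpace.inner_single_right, PiLp.norm_single]
  simp only [one_mul, norm_one, conj_trivial]
  generalize G'' (‖x‖ ^ 2) = A
  generalize G' (‖x‖ ^ 2) = B
  linear_combination (-4 * B) * hx - (4 * A * (α + ℓ x)) * hn

/-! ### The explicit solutions -/

theorem exp_bubble (x : Plane) : Real.exp (bubble x) = 64 / (8 + ‖x‖ ^ 2) ^ 2 := by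
  have h : 0 < 1 + 1 / 8 * ‖x‖ ^ 2 := by positivity
  rw [bubble, show -2 * Real.log (1 + 1 / 8 * ‖x‖ ^ 2)
    = -(2 : ℕ) * Real.log (1 + 1 / 8 * ‖x‖ ^ 2) by norm_num, neg_mul, Real.exp_neg,
    Real.exp_nat_mul, Real.exp_log h]
  field_simp
  norm_num

theorem contDiff_norm_sq_plane {n : WithTop ℕ∞} : ContDiff ℝ n fun x : Plane => ‖x‖ ^ 2 :=
  contDiff_norm_sq ℝ

theorem contDiff_coord {n : WithTop ℕ∞} (i : Fin 2) : ContDiff ℝ n fun x : Plane => x i :=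
  (EuclideanSpace.proj (𝕜 := ℝ) i).contDiff

theorem contDiff_phi0 {n : WithTop ℕ∞} : ContDiff ℝ n phi0 :=
  (contDiff_const.sub contDiff_norm_sq_plane).div (contDiff_const.add contDiff_norm_sq_plane)
    fun x => by positivity

theorem contDiff_phi1 {n : WithTop ℕ∞} : ContDiff ℝ n phi1 :=
  (contDiff_coord 0).div (contDiff_const.add contDiff_norm_sq_plane) fun x => by positivity

theorem contDiff_phi2 {n : WithTop ℕ∞} : ContDiff ℝ n phi2 :=
  (contDiff_coord 1).div (contDiff_const.add contDiff_norm_sq_plane) fun x => by positivity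

theorem hasDerivAt_eight_add (s : ℝ) : HasDerivAt (fun s : ℝ => 8 + s) 1 s :=
  (hasDerivAt_id s).const_add 8

theorem hasDerivAt_inv_eight_add {s : ℝ} (hs : 0 ≤ s) :
    HasDerivAt (fun s : ℝ => (8 + s)⁻¹) (-((8 + s) ^ 2)⁻¹) s := by
  have h : (8 + s) ≠ 0 := by positivity
  convert! (hasDerivAt_eight_add s).inv h using 1
  field_simp

theorem hasDerivAt_inv_eight_add_sq {s : ℝ} (hs : 0 ≤ s) :
    HasDerivAt (fun s : ℝ => ((8 + s) ^ 2)⁻¹) (-2 * ((8 + s) ^ 3)⁻¹) s := by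
  have h : (8 + s) ≠ 0 := by positivity
  convert! ((hasDerivAt_eight_add s).pow 2).inv (pow_ne_zero 2 h) using 1
  simp
  field_simp

theorem laplacian_phi0 (x : Plane) : (Δ phi0) x = -(64 / (8 + ‖x‖ ^ 2) ^ 2) * phi0 x := by
  rw [laplacian_radial_mul_affine (G := fun s => 16 * (8 + s)⁻¹ - 1)
    (G' := fun s => 16 * -((8 + s) ^ 2)⁻¹) (G'' := fun s => 16 * -(-2 * ((8 + s) ^ 3)⁻¹))
    (α := 1) (ℓ := 0) contDiff_phi0 (fun x => ?_)
    (fun s hs => ((hasDerivAt_inv_eight_add hs).const_mul 16).sub_const 1)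
    (fun s hs => (hasDerivAt_inv_eight_add_sq hs).neg.const_mul 16)]
  · rw [phi0]
    have : 8 + ‖x‖ ^ 2 ≠ 0 := by positivity
    simp
    field_simp
    ring
  · rw [phi0]
    have : 8 + ‖x‖ ^ 2 ≠ 0 := by positivity
    simp
    field_simp
    ring

theorem laplacian_coord_div (i : Fin 2) (x : Plane) :
    (Δ (fun x : Plane => x i / (8 + ‖x‖ ^ 2) : Plane → ℝ)) x
      = -(64 / (8 + ‖x‖ ^ 2) ^ 2) * (x i / (8 + ‖x‖ ^ 2)) := by
  rw [laplacian_radial_mul_affine (f := fun x : Plane => x i / (8 + ‖x‖ ^ 2)) (G := fun s => (8 + s)⁻¹)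
    (G' := fun s => -((8 + s) ^ 2)⁻¹) (G'' := fun s => -(-2 * ((8 + s) ^ 3)⁻¹))
    (α := 0) (ℓ := EuclideanSpace.proj i)
    ((contDiff_coord i).div (contDiff_const.add contDiff_norm_sq_plane) fun x => by positivity)
    (fun x => ?_) (fun s hs => hasDerivAt_inv_eight_add hs)
    (fun s hs => (hasDerivAt_inv_eight_add_sq hs).neg)]
  · have : 8 + ‖x‖ ^ 2 ≠ 0 := by positivity
    simp
    field_simp
    ring
  · simp
    ring

/-- The radial solution `φ₃`. -/
def phi3 (x : Plane) : ℝ := hyperFun (‖x‖ ^ 2 / (8 + ‖x‖ ^ 2))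

theorem div_eight_add_mem {s : ℝ} (hs : 0 ≤ s) : 0 ≤ s / (8 + s) ∧ s / (8 + s) < 1 :=
  ⟨by positivity, (div_lt_one (by positivity)).2 (by linarith)⟩

theorem abs_div_eight_add_lt {s : ℝ} (hs : 0 ≤ s) : |s / (8 + s)| < 1 := by
  rw [abs_of_nonneg (div_eight_add_mem hs).1]
  exact (div_eight_add_mem hs).2

theorem hasDerivAt_div_eight_add {s : ℝ} (hs : 0 ≤ s) :
    HasDerivAt (fun s : ℝ => s / (8 + s)) (8 * ((8 + s) ^ 2)⁻¹) s := by
  have h : (8 + s) ≠ 0 := by positivity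
  convert! (hasDerivAt_id s).div (hasDerivAt_eight_add s) h using 1
  simp
  field_simp

theorem contDiff_phi3 : ContDiff ℝ ∞ phi3 := by
  refine contDiff_iff_contDiffAt.2 fun x => ?_
  have h1 : ContDiffAt ℝ ∞ hyperFun (‖x‖ ^ 2 / (8 + ‖x‖ ^ 2)) :=
    polyGrowth_hyperCoeff.contDiffOn.contDiffAt
      (isOpen_Ioo.mem_nhds (abs_lt.1 (abs_div_eight_add_lt (sq_nonneg _))))
  have h2 : ContDiffAt ℝ ∞ (fun x : Plane => ‖x‖ ^ 2 / (8 + ‖x‖ ^ 2)) x :=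
    contDiff_norm_sq_plane.contDiffAt.div (contDiff_const.add contDiff_norm_sq_plane).contDiffAt
      (by positivity)
  exact h1.comp x h2

theorem contDiff_two_phi3 : ContDiff ℝ 2 phi3 := contDiff_infty.1 contDiff_phi3 2

theorem phi3_pos (x : Plane) : 0 < phi3 x :=
  hyperFun_pos (div_eight_add_mem (sq_nonneg _)).1 (div_eight_add_mem (sq_nonneg _)).2

theorem phi3_zero : phi3 0 = 1 := by simp [phi3]

theorem hasDerivAt_radial_phi3 {s : ℝ} (hs : 0 ≤ s) :
    HasDerivAt (fun s => hyperFun (s / (8 + s)))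
      (hyperFun' (s / (8 + s)) * (8 * ((8 + s) ^ 2)⁻¹)) s :=
  (hasDerivAt_hyperFun (abs_div_eight_add_lt hs)).comp s (hasDerivAt_div_eight_add hs)

/-- The substitution z = s / (8 + s), s = |x|², turns the radial equation into the hypergeometric
one. -/
theorem laplacian_phi3 (x : Plane) : (Δ phi3) x = 64 / (8 + ‖x‖ ^ 2) ^ 2 * phi3 x := by
  rw [laplacian_radial_mul_affine (G := fun s => hyperFun (s / (8 + s)))
    (G' := fun s => hyperFun' (s / (8 + s)) * (8 * ((8 + s) ^ 2)⁻¹))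
    (G'' := fun s => hyperFun'' (s / (8 + s)) * (8 * ((8 + s) ^ 2)⁻¹) * (8 * ((8 + s) ^ 2)⁻¹)
      + hyperFun' (s / (8 + s)) * (8 * (-2 * ((8 + s) ^ 3)⁻¹)))
    (α := 1) (ℓ := 0) contDiff_two_phi3 (fun x => by simp [phi3])
    (fun s hs => hasDerivAt_radial_phi3 hs)
    (fun s hs => ((hasDerivAt_hyperFun' (abs_div_eight_add_lt hs)).comp s
      (hasDerivAt_div_eight_add hs)).mul ((hasDerivAt_inv_eight_add_sq hs).const_mul 8))]
  have h := hyperFun_ode (abs_div_eight_add_lt (sq_nonneg ‖x‖))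
  have h8 : 8 + ‖x‖ ^ 2 ≠ 0 := by positivity
  rw [phi3]
  simp only [zero_apply, add_zero, mul_one, mul_zero]
  generalize hyperFun'' (‖x‖ ^ 2 / (8 + ‖x‖ ^ 2)) = A at *
  generalize hyperFun' (‖x‖ ^ 2 / (8 + ‖x‖ ^ 2)) = B at *
  generalize hyperFun (‖x‖ ^ 2 / (8 + ‖x‖ ^ 2)) = C at *
  generalize ‖x‖ ^ 2 = s at *
  have e : 64 / (8 + s) ^ 2 * C = 32 / (8 + s) ^ 2 * (2 * C) := by ring
  rw [e, ← h]
  field_simp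
  ring

/-! ### Behaviour of `φ₃` at infinity -/

theorem one_sub_div_eight_add (s : ℝ) (hs : 0 ≤ s) : 1 - s / (8 + s) = (1 + 1 / 8 * s)⁻¹ := by
  field_simp
  ring

theorem exists_phi3_sub_log_bound :
    ∃ K : ℝ, ∀ x, |phi3 x - logCoeff * Real.log (1 + 1 / 8 * ‖x‖ ^ 2)| ≤ K := by
  obtain ⟨K, hK⟩ := exists_hyperFun_add_log_bound
  refine ⟨K, fun x => ?_⟩
  have h := hK _ (div_eight_add_mem (sq_nonneg ‖x‖)).1 (div_eight_add_mem (sq_nonneg ‖x‖)).2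
  rwa [one_sub_div_eight_add _ (sq_nonneg _), Real.log_inv, mul_neg, ← sub_eq_add_neg] at h

theorem gradient_phi3 (x : Plane) :
    ∇ phi3 x = (2 * (hyperFun' (‖x‖ ^ 2 / (8 + ‖x‖ ^ 2)) * (8 * ((8 + ‖x‖ ^ 2) ^ 2)⁻¹))) • x := by
  refine HasGradientAt.gradient ?_
  rw [hasGradientAt_iff_hasFDerivAt]
  have h := (hasDerivAt_radial_phi3 (sq_nonneg ‖x‖)).comp_hasFDerivAt x
    (hasStrictFDerivAt_norm_sq x).hasFDerivAt
  convert! h using 1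
  ext v
  simp
  ring

theorem isLittleO_gradient_phi3 :
    (fun x => ∇ phi3 x - (2 * logCoeff / ‖x‖ ^ 2) • x)
      =o[cocompact Plane] (fun x => 1 / ‖x‖) := by
  have hn : Tendsto (fun x : Plane => ‖x‖ ^ 2) (cocompact Plane) atTop :=
    (tendsto_pow_atTop two_ne_zero).comp (tendsto_norm_cocompact_atTop)
  have h0 : Tendsto (fun s : ℝ => (8 + s)⁻¹) atTop (𝓝 0) :=
    tendsto_inv_atTop_zero.comp (tendsto_atTop_add_const_left _ _ tendsto_id)
  have hone : Tendsto (fun s : ℝ => s / (8 + s)) atTop (𝓝 1) := by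
    have h1 : Tendsto (fun s : ℝ => 1 - 8 * (8 + s)⁻¹) atTop (𝓝 (1 - 8 * 0)) :=
      (h0.const_mul 8).const_sub 1
    rw [mul_zero, sub_zero] at h1
    refine h1.congr' ?_
    filter_upwards [eventually_ge_atTop 0] with s hs
    field_simp
    ring
  have hz : Tendsto (fun s : ℝ => s / (8 + s)) atTop (𝓝[<] 1) := by
    refine tendsto_nhdsWithin_iff.2 ⟨hone, ?_⟩
    filter_upwards [eventually_ge_atTop 0] with s hs using (div_eight_add_mem hs).2
  have hF := tendsto_one_sub_mul_hyperFun'.comp hz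
  -- With z = s / (8 + s) one has 1 - z = 8 / (8 + s), so |x|² times the radial factor of ∇φ₃ is 2
  -- (1 - z) F'(z) z.
  have hlim : Tendsto (fun s : ℝ => 2 * ((1 - s / (8 + s)) * hyperFun' (s / (8 + s))) * (s / (8 + s))
      - 2 * logCoeff) atTop (𝓝 0) := by
    have := ((hF.const_mul 2).mul hone).sub_const (2 * logCoeff)
    simpa using this
  have hlim' := hlim.comp hn
  rw [isLittleO_iff]
  intro c hc
  have h1 : ∀ᶠ x : Plane in cocompact Plane, (1 : ℝ) ≤ ‖x‖ :=
    tendsto_norm_cocompact_atTop.eventually_ge_atTop 1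
  filter_upwards [h1, (Metric.tendsto_nhds.1 hlim' c hc)] with x hx1 hx2
  have hx : 0 < ‖x‖ := by linarith
  rw [Function.comp_apply, dist_zero_right] at hx2
  rw [gradient_phi3, ← sub_smul, norm_smul, norm_div, norm_one, norm_norm]
  have e : 2 * (hyperFun' (‖x‖ ^ 2 / (8 + ‖x‖ ^ 2)) * (8 * ((8 + ‖x‖ ^ 2) ^ 2)⁻¹))
      - 2 * logCoeff / ‖x‖ ^ 2 = (2 * ((1 - ‖x‖ ^ 2 / (8 + ‖x‖ ^ 2)) *
        hyperFun' (‖x‖ ^ 2 / (8 + ‖x‖ ^ 2))) * (‖x‖ ^ 2 / (8 + ‖x‖ ^ 2))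
      - 2 * logCoeff) / ‖x‖ ^ 2 := by
    field_simp
    ring
  rw [e, norm_div, norm_pow, norm_norm]
  calc _ = ‖2 * ((1 - ‖x‖ ^ 2 / (8 + ‖x‖ ^ 2)) *
        hyperFun' (‖x‖ ^ 2 / (8 + ‖x‖ ^ 2))) * (‖x‖ ^ 2 / (8 + ‖x‖ ^ 2))
      - 2 * logCoeff‖ * (1 / ‖x‖) := by field_simp
    _ ≤ c * (1 / ‖x‖) := by gcongr

/-! ### Radial ordinary differential equations -/

/-- `m` solves `r (r m')' = q m` for `r > 0`, with derivative `m'` continuous on the line. -/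
structure IsRadialSolution (q m m' : ℝ → ℝ) : Prop where
  hasDerivAt : ∀ r, HasDerivAt m (m' r) r
  continuous_deriv : Continuous m'
  ode : ∀ r, 0 < r → HasDerivAt (fun r => r * m' r) (q r * m r / r) r

namespace IsRadialSolution

variable {q m m' p p' : ℝ → ℝ}

theorem continuous (h : IsRadialSolution q m m') : Continuous m :=
  continuous_iff_continuousAt.2 fun r => (h.hasDerivAt r).continuousAt

/-- The Wronskian of two solutions regular at the origin vanishes. -/
theorem wronskian (hm : IsRadialSolution q m m') (hp : IsRadialSolution q p p') {r : ℝ}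
    (hr : 0 < r) : p r * m' r = p' r * m r := by
  set W : ℝ → ℝ := fun r => p r * (r * m' r) - r * p' r * m r with hW
  have hc : ContinuousOn W (Set.Icc 0 r) := by
    have := hm.continuous
    have := hp.continuous
    have := hm.continuous_deriv
    have := hp.continuous_deriv
    fun_prop
  -- The equation says nothing at s = 0. W is shown constant on (0, r], and W(0) = 0 is carried over
  -- by continuity.
  have hd : ∀ s ∈ Set.Ico 0 r, HasDerivWithinAt W 0 (Set.Ici s) s ∨ s = 0 := by
    intro s hs
    rcases eq_or_lt_of_le hs.1 with h0 | h0
    · exact Or.inr h0.symm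
    left
    have h := ((hp.hasDerivAt s).mul (hm.ode s h0)).sub ((hp.ode s h0).mul (hm.hasDerivAt s))
    have e : p' s * (s * m' s) + p s * (q s * m s / s) - (q s * p s / s * m s + s * p' s * m' s)
        = 0 := by ring
    rw [e] at h
    exact h.hasDerivWithinAt
  have hconst : ∀ s ∈ Set.Ioc 0 r, W s = W r := by
    intro s hs
    have h1 := constant_of_has_deriv_right_zero (f := W) (a := s) (b := r)
      (hc.mono (Set.Icc_subset_Icc_left hs.1.le)) (fun t ht => by
        rcases hd t ⟨hs.1.le.trans ht.1, ht.2⟩ with h | h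
        · exact h
        · exact absurd h (hs.1.trans_le ht.1).ne') r ⟨hs.2, le_rfl⟩
    exact h1.symm
  have hlim : Tendsto W (𝓝[>] 0) (𝓝 (W 0)) := by
    have hc' : Continuous W := by
      have := hm.continuous
      have := hp.continuous
      have := hm.continuous_deriv
      have := hp.continuous_deriv
      fun_prop
    exact hc'.continuousWithinAt
  have hlim2 : Tendsto W (𝓝[>] 0) (𝓝 (W r)) := by
    refine tendsto_const_nhds.congr' ?_
    filter_upwards [Ioc_mem_nhdsGT hr] with s hs using (hconst s hs).symm
  have h0 := tendsto_nhds_unique hlim hlim2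
  simp only [hW, zero_mul, mul_zero, sub_zero] at h0
  have : r * (p r * m' r - p' r * m r) = 0 := by linarith
  rcases mul_eq_zero.1 this with h | h
  · exact absurd h hr.ne'
  · linarith

/-- Regular solutions are proportional on intervals where one of them does not vanish. -/
theorem exists_eq_mul (hm : IsRadialSolution q m m') (hp : IsRadialSolution q p p') {S : Set ℝ}
    (hS : IsOpen S) (hS' : IsPreconnected S) (hpos : S ⊆ Set.Ioi 0) (hne : ∀ r ∈ S, p r ≠ 0) :
    ∃ c, ∀ r ∈ closure S, m r = c * p r ∧ m' r = c * p' r := by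
  have hd : ∀ r ∈ S, HasDerivAt (fun r => m r / p r) 0 r := by
    intro r hr
    have h := (hm.hasDerivAt r).div (hp.hasDerivAt r) (hne r hr)
    have e : (m' r * p r - m r * p' r) / p r ^ 2 = 0 := by
      rw [div_eq_zero_iff]; left
      linarith [hm.wronskian hp (hpos hr)]
    rwa [e] at h
  obtain ⟨c, hc⟩ := hS.exists_is_const_of_deriv_eq_zero hS'
    (fun r hr => (hd r hr).differentiableAt.differentiableWithinAt) (fun r hr => (hd r hr).deriv)
  refine ⟨c, fun r hr => ?_⟩
  have h1 : ∀ r ∈ S, m r = c * p r := fun r hr => by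
    rw [← hc r hr, div_mul_cancel₀ _ (hne r hr)]
  have h2 : ∀ r ∈ S, m' r = c * p' r := fun r hr => by
    have hw := hm.wronskian hp (hpos hr)
    rw [h1 r hr] at hw
    have := hne r hr
    refine mul_left_cancel₀ this ?_
    linear_combination hw
  exact ⟨Set.EqOn.closure (f := m) (g := fun r => c * p r) h1 hm.continuous
      (continuous_const.mul hp.continuous) hr,
    Set.EqOn.closure (f := m') (g := fun r => c * p' r) h2 hm.continuous_deriv
      (continuous_const.mul hp.continuous_deriv) hr⟩

/-- A solution with vanishing Cauchy datum, relative to a nonvanishing solution, is zero. -/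
theorem eq_zero_on_closure (hm : IsRadialSolution q m m') (hp : IsRadialSolution q p p')
    {S : Set ℝ} (hS : IsOpen S) (hS' : IsPreconnected S) (hpos : S ⊆ Set.Ioi 0)
    (hne : ∀ r ∈ S, p r ≠ 0) {r₀ : ℝ} (hr₀ : r₀ ∈ closure S)
    (h0 : m r₀ = 0 ∧ p r₀ ≠ 0 ∨ m' r₀ = 0 ∧ p' r₀ ≠ 0) :
    ∀ r ∈ closure S, m r = 0 ∧ m' r = 0 := by
  obtain ⟨c, hc⟩ := hm.exists_eq_mul hp hS hS' hpos hne
  have hc0 : c = 0 := by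
    rcases h0 with ⟨h1, h2⟩ | ⟨h1, h2⟩
    · have := (hc r₀ hr₀).1
      rw [h1] at this
      exact (mul_eq_zero.1 this.symm).resolve_right h2
    · have := (hc r₀ hr₀).2
      rw [h1] at this
      exact (mul_eq_zero.1 this.symm).resolve_right h2
  intro r hr
  have := hc r hr
  rwa [hc0, zero_mul, zero_mul] at this

/-- If `q ≥ 1`, a solution vanishing at the origin with sublinear growth is zero. -/
theorem eq_zero_of_growth (hm : IsRadialSolution q m m') (hq : ∀ r, 0 < r → 1 ≤ q r)
    (h0 : m 0 = 0) {C τ : ℝ} (hτ : τ < 1) (hg : ∀ r, 0 ≤ r → |m r| ≤ C * (1 + r) ^ τ) :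
    ∀ r, 0 ≤ r → m r = 0 := by
  -- T = r (m²)' / 2. For q ≥ 1 it satisfies T' ≥ 2 T / r by completing a square, so T / r² is
  -- nondecreasing.
  set T : ℝ → ℝ := fun r => r * m' r * m r with hT
  have hTc : Continuous T := by
    have := hm.continuous
    have := hm.continuous_deriv
    fun_prop
  have hTd : ∀ r, 0 < r → HasDerivAt T (q r * m r / r * m r + r * m' r * m' r) r :=
    fun r hr => (hm.ode r hr).mul (hm.hasDerivAt r)
  have hTineq : ∀ r, 0 < r → 2 * T r / r ≤ q r * m r / r * m r + r * m' r * m' r := by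
    intro r hr
    have e : q r * m r / r * m r + r * m' r * m' r - 2 * T r / r
        = ((q r - 1) * m r ^ 2 + (m r - r * m' r) ^ 2) / r := by
      simp only [hT]; field_simp; ring
    have : 0 ≤ ((q r - 1) * m r ^ 2 + (m r - r * m' r) ^ 2) / r := by
      have := sub_nonneg.2 (hq r hr)
      positivity
    linarith
  have hTmono : MonotoneOn T (Set.Ici 0) := by
    refine monotoneOn_of_hasDerivWithinAt_nonneg (convex_Ici 0) hTc.continuousOn
      (f' := fun r => q r * m r / r * m r + r * m' r * m' r) (fun r hr => ?_) (fun r hr => ?_)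
    · rw [interior_Ici] at hr
      exact (hTd r hr).hasDerivWithinAt
    · rw [interior_Ici, Set.mem_Ioi] at hr
      have h1 : 0 ≤ q r := zero_le_one.trans (hq r hr)
      have : q r * m r / r * m r + r * m' r * m' r = q r * m r ^ 2 / r + r * m' r ^ 2 := by ring
      rw [this]
      positivity
  have hTnn : ∀ r, 0 ≤ r → 0 ≤ T r := fun r hr => by
    have := hTmono (Set.self_mem_Ici) hr hr
    simpa [hT] using this
  have hquot : MonotoneOn (fun r => T r / r ^ 2) (Set.Ioi 0) := by
    have hd : ∀ r, 0 < r → HasDerivAt (fun r => T r / r ^ 2)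
        (((q r * m r / r * m r + r * m' r * m' r) * r ^ 2 - T r * (2 * r)) / (r ^ 2) ^ 2) r := by
      intro r hr
      convert! (hTd r hr).div (hasDerivAt_pow 2 r) (pow_ne_zero 2 hr.ne') using 1
      simp
    refine monotoneOn_of_hasDerivWithinAt_nonneg (convex_Ioi 0)
      (fun r hr => (hd r hr).continuousAt.continuousWithinAt)
      (fun r hr => (hd r (by simpa using hr)).hasDerivWithinAt) (fun r hr => ?_)
    rw [interior_Ioi, Set.mem_Ioi] at hr
    have h1 := hTineq r hr
    rw [div_le_iff₀ hr] at h1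
    refine div_nonneg ?_ (by positivity)
    nlinarith
  have hsq : ∀ r, HasDerivAt (fun r => m r ^ 2) (2 * m r * m' r) r := fun r => by
    convert! (hm.hasDerivAt r).pow 2 using 1
    simp
  -- If T(r) > 0, then T(s) ≥ c s² for s ≥ r, so (m²)' ≥ 2 c s and m² grows quadratically, which an
  -- exponent τ < 1 excludes.
  have hTzero : ∀ r, 0 < r → T r = 0 := by
    intro r hr
    by_contra hne
    have hpos : 0 < T r := lt_of_le_of_ne (hTnn r hr.le) (Ne.symm hne)
    set c := T r / r ^ 2 with hc
    have hcpos : 0 < c := by positivity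
    have hle : ∀ s, r ≤ s → c * s ^ 2 ≤ T s := by
      intro s hs
      have hs0 : 0 < s := hr.trans_le hs
      have := hquot hr hs0 hs
      exact (le_div_iff₀ (by positivity)).1 this
    have hmono : MonotoneOn (fun s => m s ^ 2 - c * s ^ 2) (Set.Ici r) := by
      have hd : ∀ s, HasDerivAt (fun s => m s ^ 2 - c * s ^ 2) (2 * m s * m' s - c * (2 * s)) s :=
        fun s => by
          convert! (hsq s).sub ((hasDerivAt_pow 2 s).const_mul c) using 1
          simp
      refine monotoneOn_of_hasDerivWithinAt_nonneg (convex_Ici r)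
        (fun s _ => (hd s).continuousAt.continuousWithinAt)
        (fun s _ => (hd s).hasDerivWithinAt) (fun s hs => ?_)
      rw [interior_Ici, Set.mem_Ioi] at hs
      have hs0 : 0 < s := hr.trans hs
      have h1 := hle s hs.le
      simp only [hT] at h1
      have : c * s ≤ m' s * m s := by
        refine le_of_mul_le_mul_left ?_ hs0
        linarith
      linarith
    have hlow : ∀ s, r ≤ s → c * s ^ 2 - c * r ^ 2 ≤ m s ^ 2 := by
      intro s hs
      have := hmono (Set.self_mem_Ici) hs hs
      have h2 : 0 ≤ m r ^ 2 := sq_nonneg _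
      simp only at this
      linarith
    have hlim : Tendsto (fun s : ℝ => (C * ((1 + s) ^ τ / (1 + s))) ^ 2 * ((1 + s) / s) ^ 2
        + c * r ^ 2 * (s⁻¹) ^ 2) atTop (𝓝 ((C * 0) ^ 2 * 1 ^ 2 + c * r ^ 2 * 0 ^ 2)) := by
      have ha : Tendsto (fun s : ℝ => 1 + s) atTop atTop :=
        tendsto_atTop_add_const_left _ _ tendsto_id
      have h1 : Tendsto (fun s : ℝ => (1 + s) ^ τ / (1 + s)) atTop (𝓝 0) := by
        have := (tendsto_rpow_neg_atTop (y := 1 - τ) (by linarith)).comp ha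
        refine this.congr' ?_
        filter_upwards [eventually_ge_atTop 0] with s hs
        rw [Function.comp_apply, neg_sub, Real.rpow_sub_one (by positivity)]
      have h2 : Tendsto (fun s : ℝ => (1 + s) / s) atTop (𝓝 1) := by
        have := (tendsto_inv_atTop_zero (𝕜 := ℝ)).add_const 1
        rw [zero_add] at this
        refine this.congr' ?_
        filter_upwards [eventually_gt_atTop 0] with s hs
        field_simp
      exact (((h1.const_mul C).pow 2).mul (h2.pow 2)).add
        ((tendsto_inv_atTop_zero.pow 2).const_mul _)
    rw [show (C * 0) ^ 2 * 1 ^ 2 + c * r ^ 2 * 0 ^ 2 = 0 by ring] at hlim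
    have hge : ∀ᶠ s : ℝ in atTop, c ≤ (C * ((1 + s) ^ τ / (1 + s))) ^ 2 * ((1 + s) / s) ^ 2
        + c * r ^ 2 * (s⁻¹) ^ 2 := by
      filter_upwards [eventually_ge_atTop r] with s hs
      have hs0 : 0 < s := hr.trans_le hs
      have h1 := hlow s hs
      have h2 : m s ^ 2 ≤ (C * (1 + s) ^ τ) ^ 2 := by
        rw [← sq_abs (m s)]
        have := hg s hs0.le
        gcongr
      have e : (C * ((1 + s) ^ τ / (1 + s))) ^ 2 * ((1 + s) / s) ^ 2 + c * r ^ 2 * (s⁻¹) ^ 2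
          = ((C * (1 + s) ^ τ) ^ 2 + c * r ^ 2) / s ^ 2 := by
        field_simp
      rw [e, le_div_iff₀ (by positivity)]
      linarith
    exact absurd (ge_of_tendsto hlim hge) (not_le.2 hcpos)
  intro r hr
  have hconst := constant_of_has_deriv_right_zero (f := fun r => m r ^ 2) (a := 0) (b := r)
    (fun s _ => (hsq s).continuousAt.continuousWithinAt) (fun s hs => by
      have e : 2 * m s * m' s = 0 := by
        rcases eq_or_lt_of_le hs.1 with h | h
        · rw [← h, h0]; ring
        · have := hTzero s h
          simp only [hT] at this
          rcases mul_eq_zero.1 this with h' | h'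
          · rw [(mul_eq_zero.1 h').resolve_left h.ne', mul_zero]
          · rw [h']; ring
      have := hsq s
      rw [e] at this
      exact this.hasDerivWithinAt) r ⟨hr, le_rfl⟩
  simpa [h0] using hconst

end IsRadialSolution

/-! ### Angular modes -/

theorem hasDerivAt_intervalIntegral_param {F F' : ℝ → ℝ → ℝ} {a b : ℝ}
    (hF : ∀ r, Continuous (F r)) (hF' : Continuous (Function.uncurry F'))
    (h : ∀ r θ, HasDerivAt (fun r => F r θ) (F' r θ) r) (r : ℝ) :
    HasDerivAt (fun r => ∫ θ in a..b, F r θ) (∫ θ in a..b, F' r θ) r := by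
  obtain ⟨M, hM⟩ := ((isCompact_Icc (a := r - 1) (b := r + 1)).prod
    (isCompact_uIcc (a := a) (b := b))).exists_bound_of_continuousOn hF'.continuousOn
  refine (intervalIntegral.hasDerivAt_integral_of_dominated_loc_of_deriv_le
    (bound := fun _ => M) (Icc_mem_nhds (by linarith) (by linarith : r < r + 1))
    (Eventually.of_forall fun r => (hF r).aestronglyMeasurable)
    ((hF r).intervalIntegrable _ _)
    (hF'.comp (Continuous.prodMk_right r)).aestronglyMeasurable
    (Eventually.of_forall fun θ hθ s hs => hM (s, θ) ⟨hs, Set.uIoc_subset_uIcc hθ⟩)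
    (by simp) (Eventually.of_forall fun θ _ s _ => h s θ)).2

/-- The unit vector with angle `θ`. -/
def dir (θ : ℝ) : Plane :=
  Real.cos θ • EuclideanSpace.single 0 1 + Real.sin θ • EuclideanSpace.single 1 1

/-- The unit vector orthogonal to `dir θ`. -/
def dirPerp (θ : ℝ) : Plane :=
  (-Real.sin θ) • EuclideanSpace.single 0 1 + Real.cos θ • EuclideanSpace.single 1 1

theorem hasDerivAt_dir (θ : ℝ) : HasDerivAt dir (dirPerp θ) θ :=
  ((Real.hasDerivAt_cos θ).smul_const _).add ((Real.hasDerivAt_sin θ).smul_const _)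

theorem hasDerivAt_dirPerp (θ : ℝ) : HasDerivAt dirPerp (-dir θ) θ := by
  convert! ((Real.hasDerivAt_sin θ).neg.smul_const (EuclideanSpace.single 0 1 : Plane)).add
    ((Real.hasDerivAt_cos θ).smul_const (EuclideanSpace.single 1 1 : Plane)) using 1
  rw [dir, neg_add, neg_smul, neg_smul]

theorem continuous_dir : Continuous dir :=
  continuous_iff_continuousAt.2 fun θ => (hasDerivAt_dir θ).continuousAt

theorem continuous_dirPerp : Continuous dirPerp :=
  continuous_iff_continuousAt.2 fun θ => (hasDerivAt_dirPerp θ).continuousAt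

theorem norm_dir (θ : ℝ) : ‖dir θ‖ = 1 := by
  have : ‖dir θ‖ ^ 2 = 1 := by
    rw [EuclideanSpace.norm_sq_eq]
    simp [dir, Real.cos_sq_add_sin_sq]
  exact (pow_eq_one_iff_of_nonneg (norm_nonneg _) two_ne_zero).1 this

theorem norm_sq_smul_dir (r θ : ℝ) : ‖r • dir θ‖ ^ 2 = r ^ 2 := by
  rw [norm_smul, norm_dir, mul_one, Real.norm_eq_abs, sq_abs]

/-- The trace of the Hessian is the same in the rotated orthonormal frame. -/
theorem laplacian_eq_polar (f : Plane → ℝ) (x : Plane) (θ : ℝ) :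
    (Δ f) x = fderiv ℝ (fderiv ℝ f) x (dir θ) (dir θ)
      + fderiv ℝ (fderiv ℝ f) x (dirPerp θ) (dirPerp θ) := by
  rw [laplacian_eq_fderiv_fderiv]
  simp only [dir, dirPerp, Fin.sum_univ_two, map_add, map_smul, add_apply, smul_apply, smul_eq_mul]
  linear_combination (-(fderiv ℝ (fderiv ℝ f) x (EuclideanSpace.single 0 1))
    (EuclideanSpace.single 0 1) - (fderiv ℝ (fderiv ℝ f) x (EuclideanSpace.single 1 1))
    (EuclideanSpace.single 1 1)) * Real.cos_sq_add_sin_sq θ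

/-- `χ` is a `2π`-periodic eigenfunction of `d²/dθ²` with eigenvalue `-k²`, bounded by one. -/
structure IsAngularMode (k : ℝ) (χ χ' : ℝ → ℝ) : Prop where
  hasDerivAt : ∀ θ, HasDerivAt χ (χ' θ) θ
  hasDerivAt' : ∀ θ, HasDerivAt χ' (-k ^ 2 * χ θ) θ
  periodic : χ (2 * Real.pi) = χ 0
  periodic' : χ' (2 * Real.pi) = χ' 0
  abs_le : ∀ θ, |χ θ| ≤ 1

theorem IsAngularMode.continuous {k : ℝ} {χ χ' : ℝ → ℝ} (h : IsAngularMode k χ χ') :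
    Continuous χ :=
  continuous_iff_continuousAt.2 fun r => (h.hasDerivAt r).continuousAt

theorem IsAngularMode.continuous' {k : ℝ} {χ χ' : ℝ → ℝ} (h : IsAngularMode k χ χ') :
    Continuous χ' :=
  continuous_iff_continuousAt.2 fun r => (h.hasDerivAt' r).continuousAt

theorem isAngularMode_cos (k : ℕ) :
    IsAngularMode k (fun θ => Real.cos (k * θ)) (fun θ => -(k * Real.sin (k * θ))) where
  hasDerivAt θ := by
    convert! ((hasDerivAt_id θ).const_mul (k : ℝ)).cos using 1
    simp; ring
  hasDerivAt' θ := by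
    convert! (((hasDerivAt_id θ).const_mul (k : ℝ)).sin.const_mul (k : ℝ)).neg using 1
    simp; ring
  periodic := by simp [Real.cos_nat_mul_two_pi]
  periodic' := by
    have := Real.sin_nat_mul_pi (k * 2)
    push_cast at this
    rw [mul_assoc] at this
    simp [this]
  abs_le θ := Real.abs_cos_le_one _

theorem isAngularMode_sin (k : ℕ) :
    IsAngularMode k (fun θ => Real.sin (k * θ)) (fun θ => k * Real.cos (k * θ)) where
  hasDerivAt θ := by
    convert! ((hasDerivAt_id θ).const_mul (k : ℝ)).sin using 1
    simp; ring
  hasDerivAt' θ := by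
    convert! ((hasDerivAt_id θ).const_mul (k : ℝ)).cos.const_mul (k : ℝ) using 1
    simp; ring
  periodic := by
    have := Real.sin_nat_mul_pi (k * 2)
    push_cast at this
    rw [mul_assoc] at this
    simp [this]
  periodic' := by simp [Real.cos_nat_mul_two_pi]
  abs_le θ := Real.abs_sin_le_one _

/-- The angular mode of `w` on the circle of radius `r`. -/
def mode (w : Plane → ℝ) (χ : ℝ → ℝ) (r : ℝ) : ℝ :=
  ∫ θ in (0 : ℝ)..2 * Real.pi, w (r • dir θ) * χ θ

/-- The radial derivative of `mode`. -/
def modeDeriv (w : Plane → ℝ) (χ : ℝ → ℝ) (r : ℝ) : ℝ :=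
  ∫ θ in (0 : ℝ)..2 * Real.pi, fderiv ℝ w (r • dir θ) (dir θ) * χ θ

/-- `w` is a classical solution of `Δ w = κ e ^ U w`. -/
structure IsScalarSolution (κ : ℝ) (w : Plane → ℝ) : Prop where
  contDiff : ContDiff ℝ 2 w
  eq : ∀ x, (Δ w) x = κ * (64 / (8 + ‖x‖ ^ 2) ^ 2) * w x

/-- The coefficient of the radial equation of the modes of frequency `k`. -/
def modeCoeff (κ k : ℝ) (r : ℝ) : ℝ := k ^ 2 + κ * (64 * r ^ 2 / (8 + r ^ 2) ^ 2)

/-- In polar form r² Δ = r ∂_r (r ∂_r) + ∂_θ². Integration against χ over a period moves ∂_θ² onto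
χ, where it becomes -k². -/
theorem IsScalarSolution.isRadialSolution {κ k : ℝ} {w : Plane → ℝ} {χ χ' : ℝ → ℝ}
    (hw : IsScalarSolution κ w) (hχ : IsAngularMode k χ χ') :
    IsRadialSolution (modeCoeff κ k) (mode w χ) (modeDeriv w χ) := by
  have hw2 := hw.contDiff
  have hc0 : Continuous w := hw2.continuous
  have hC1 : ContDiff ℝ 1 (fderiv ℝ w) := hw2.fderiv_right (by norm_num)
  have hc1 : Continuous (fderiv ℝ w) := hC1.continuous
  have hc2 : Continuous (fderiv ℝ (fderiv ℝ w)) := hC1.continuous_fderiv (by norm_num)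
  have hD0 : ∀ x, HasFDerivAt w (fderiv ℝ w x) x := fun x =>
    (hw2.differentiable (by norm_num) x).hasFDerivAt
  have hD1 : ∀ x, HasFDerivAt (fderiv ℝ w) (fderiv ℝ (fderiv ℝ w) x) x := fun x =>
    (hC1.differentiable (by norm_num) x).hasFDerivAt
  have hχc := hχ.continuous
  have hχc' := hχ.continuous'
  have hdir := continuous_dir
  have hdirP := continuous_dirPerp
  have hray : ∀ r θ : ℝ, HasDerivAt (fun r : ℝ => r • dir θ) (dir θ) r := fun r θ => by
    simpa using (hasDerivAt_id r).smul_const (dir θ)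
  -- The integral makes sense for negative r as well, so differentiability across 0 encodes
  -- regularity at the origin.
  have hderiv : ∀ r, HasDerivAt (mode w χ) (modeDeriv w χ r) r := by
    refine hasDerivAt_intervalIntegral_param (F := fun r θ => w (r • dir θ) * χ θ)
      (F' := fun r θ => fderiv ℝ w (r • dir θ) (dir θ) * χ θ) (fun r => by fun_prop)
      (by unfold Function.uncurry; fun_prop) (fun r θ => ?_)
    exact ((hD0 _).comp_hasDerivAt r (hray r θ)).mul_const (χ θ)
  have hderiv2 : ∀ r, HasDerivAt (modeDeriv w χ) (∫ θ in (0 : ℝ)..2 * Real.pi,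
      fderiv ℝ (fderiv ℝ w) (r • dir θ) (dir θ) (dir θ) * χ θ) r := by
    refine hasDerivAt_intervalIntegral_param
      (F := fun r θ => fderiv ℝ w (r • dir θ) (dir θ) * χ θ)
      (F' := fun r θ => fderiv ℝ (fderiv ℝ w) (r • dir θ) (dir θ) (dir θ) * χ θ)
      (fun r => by fun_prop) (by unfold Function.uncurry; fun_prop) (fun r θ => ?_)
    have h := ((hD1 _).comp_hasDerivAt r (hray r θ)).clm_apply (hasDerivAt_const r (dir θ))
    rw [map_zero, add_zero] at h
    exact h.mul_const (χ θ)
  refine ⟨hderiv, continuous_iff_continuousAt.2 fun r => (hderiv2 r).continuousAt, fun r hr => ?_⟩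
  have h := (hasDerivAt_id r).mul (hderiv2 r)
  convert! h using 1
  -- `g₂` is the second θ-derivative of w along the circle; the first-order term comes from the
  -- curvature of the circle.
  set g₂ : ℝ → ℝ := fun θ => r ^ 2 * fderiv ℝ (fderiv ℝ w) (r • dir θ) (dirPerp θ) (dirPerp θ)
    - r * fderiv ℝ w (r • dir θ) (dir θ) with hg₂
  have hang : ∫ θ in (0 : ℝ)..2 * Real.pi, (g₂ θ * χ θ + k ^ 2 * (w (r • dir θ) * χ θ)) = 0 := by
    have hpath : ∀ θ, HasDerivAt (fun θ => r • dir θ) (r • dirPerp θ) θ := fun θ =>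
      (hasDerivAt_dir θ).const_smul r
    have h1 : ∀ θ, HasDerivAt (fun θ => w (r • dir θ))
        (fderiv ℝ w (r • dir θ) (r • dirPerp θ)) θ := fun θ =>
      (hD0 _).comp_hasDerivAt θ (hpath θ)
    have h2 : ∀ θ, HasDerivAt (fun θ => fderiv ℝ w (r • dir θ) (r • dirPerp θ)) (g₂ θ) θ := by
      intro θ
      have h := ((hD1 _).comp_hasDerivAt θ (hpath θ)).clm_apply
        ((hasDerivAt_dirPerp θ).const_smul r)
      convert! h using 1
      simp [hg₂]
      ring
    -- The integrand has the periodic primitive (∂_θ w) χ - w χ', so both integrations by parts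
    -- happen at once.
    have h3 : ∀ θ, HasDerivAt (fun θ => fderiv ℝ w (r • dir θ) (r • dirPerp θ) * χ θ
        - w (r • dir θ) * χ' θ) (g₂ θ * χ θ + k ^ 2 * (w (r • dir θ) * χ θ)) θ := by
      intro θ
      convert! ((h2 θ).mul (hχ.hasDerivAt θ)).sub ((h1 θ).mul (hχ.hasDerivAt' θ)) using 1
      ring
    rw [intervalIntegral.integral_eq_sub_of_hasDerivAt (fun θ _ => h3 θ)
      (Continuous.intervalIntegrable (by fun_prop) _ _), hχ.periodic, hχ.periodic']
    have e1 : dir (2 * Real.pi) = dir 0 := by simp [dir]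
    have e2 : dirPerp (2 * Real.pi) = dirPerp 0 := by simp [dirPerp]
    rw [e1, e2, sub_self]
  have hsum : 1 * modeDeriv w χ r + r * (∫ θ in (0 : ℝ)..2 * Real.pi,
        fderiv ℝ (fderiv ℝ w) (r • dir θ) (dir θ) (dir θ) * χ θ)
      = r⁻¹ * ((∫ θ in (0 : ℝ)..2 * Real.pi, (r * (fderiv ℝ w (r • dir θ) (dir θ) * χ θ)
        + r ^ 2 * (fderiv ℝ (fderiv ℝ w) (r • dir θ) (dir θ) (dir θ) * χ θ)))
        + ∫ θ in (0 : ℝ)..2 * Real.pi, (g₂ θ * χ θ + k ^ 2 * (w (r • dir θ) * χ θ))) := by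
    rw [hang, intervalIntegral.integral_add (Continuous.intervalIntegrable (by fun_prop) _ _)
      (Continuous.intervalIntegrable (by fun_prop) _ _), intervalIntegral.integral_const_mul,
      intervalIntegral.integral_const_mul, modeDeriv]
    field_simp
    ring
  rw [id, hsum, ← intervalIntegral.integral_add (Continuous.intervalIntegrable (by fun_prop) _ _)
      (Continuous.intervalIntegrable (by fun_prop) _ _), mode, div_eq_inv_mul,
      ← intervalIntegral.integral_const_mul]
  congr 1
  refine intervalIntegral.integral_congr fun θ _ => ?_
  have hl := laplacian_eq_polar w (r • dir θ) θ
  rw [hw.eq, norm_sq_smul_dir] at hl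
  simp only [hg₂, modeCoeff]
  linear_combination r ^ 2 * χ θ * hl

theorem abs_mode_le {w : Plane → ℝ} {k C τ : ℝ} {χ χ' : ℝ → ℝ} (hχ : IsAngularMode k χ χ')
    (hg : ∀ x, |w x| ≤ C * (1 + ‖x‖) ^ τ) {r : ℝ} (hr : 0 ≤ r) :
    |mode w χ r| ≤ (C * (2 * Real.pi)) * (1 + r) ^ τ := by
  have h := intervalIntegral.norm_integral_le_of_norm_le_const (a := 0) (b := 2 * Real.pi)
    (f := fun θ => w (r • dir θ) * χ θ) (C := C * (1 + r) ^ τ) (fun θ _ => ?_)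
  · rw [sub_zero, abs_of_pos Real.two_pi_pos, Real.norm_eq_abs] at h
    rw [mode]
    linarith
  · have h1 := hg (r • dir θ)
    rw [norm_smul, norm_dir, mul_one, Real.norm_eq_abs r, abs_of_nonneg hr] at h1
    rw [Real.norm_eq_abs, abs_mul]
    calc _ ≤ |w (r • dir θ)| * 1 := by gcongr; exact hχ.abs_le θ
      _ ≤ _ := by rwa [mul_one]

theorem mode_zero_of_eq_zero {w : Plane → ℝ} (h : w 0 = 0) (χ : ℝ → ℝ) : mode w χ 0 = 0 := by
  simp [mode, h]

theorem modeDeriv_zero_of_fderiv_eq_zero {w : Plane → ℝ} (h : fderiv ℝ w 0 = 0) (χ : ℝ → ℝ) :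
    modeDeriv w χ 0 = 0 := by
  simp [modeDeriv, h]

/-! ### Completeness of the modes -/

theorem exists_eq_smul_dir (x : Plane) : ∃ θ, x = ‖x‖ • dir θ := by
  have hn : ‖(⟨x 0, x 1⟩ : ℂ)‖ = ‖x‖ := by
    rw [← sq_eq_sq₀ (norm_nonneg _) (norm_nonneg _), EuclideanSpace.norm_sq_eq, Complex.sq_norm,
      Complex.normSq_mk]
    simp
    ring
  refine ⟨Complex.arg ⟨x 0, x 1⟩, ?_⟩
  have h1 := Complex.norm_mul_cos_arg ⟨x 0, x 1⟩
  have h2 := Complex.norm_mul_sin_arg ⟨x 0, x 1⟩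
  rw [hn] at h1 h2
  ext i
  fin_cases i
  · simpa [dir] using h1.symm
  · simpa [dir] using h2.symm

theorem eq_zero_of_modes_eq_zero {w : Plane → ℝ} (hw : Continuous w)
    (hcos : ∀ (k : ℕ) (r : ℝ), 0 ≤ r → mode w (fun θ => Real.cos (k * θ)) r = 0)
    (hsin : ∀ (k : ℕ) (r : ℝ), 0 ≤ r → mode w (fun θ => Real.sin (k * θ)) r = 0) (x : Plane) :
    w x = 0 := by
  obtain ⟨θ₀, hx⟩ := exists_eq_smul_dir x
  set r := ‖x‖ with hr
  have hr0 : 0 ≤ r := norm_nonneg x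
  have : Fact (0 < 2 * Real.pi) := ⟨Real.two_pi_pos⟩
  have hcosc : Continuous fun a : AddCircle (2 * Real.pi) => Real.Angle.cos a :=
    Real.Angle.continuous_cos
  have hsinc : Continuous fun a : AddCircle (2 * Real.pi) => Real.Angle.sin a :=
    Real.Angle.continuous_sin
  let f : C(AddCircle (2 * Real.pi), ℂ) :=
    ⟨fun a => (w (r • (Real.Angle.cos a • EuclideanSpace.single 0 1
      + Real.Angle.sin a • EuclideanSpace.single 1 1)) : ℂ), by fun_prop⟩
  have hf : ∀ θ : ℝ, f (θ : AddCircle (2 * Real.pi)) = (w (r • dir θ) : ℂ) := fun θ => rfl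
  have hdir := continuous_dir
  -- Parity of cosine and sine extends the hypotheses to negative frequencies.
  have hint : ∀ k : ℤ, (∫ θ in (0 : ℝ)..2 * Real.pi, w (r • dir θ) * Real.cos (k * θ)) = 0 ∧
      (∫ θ in (0 : ℝ)..2 * Real.pi, w (r • dir θ) * Real.sin (k * θ)) = 0 := by
    intro k
    have hc := hcos k.natAbs r hr0
    have hs := hsin k.natAbs r hr0
    rw [mode] at hc hs
    rcases Int.natAbs_eq k with h | h
    · have h' : (k : ℝ) = (k.natAbs : ℝ) := by rw [h]; simp
      rw [h']
      exact ⟨hc, hs⟩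
    · have h' : (k : ℝ) = -(k.natAbs : ℝ) := by rw [h]; simp
      rw [h']
      simp only [neg_mul, Real.cos_neg, Real.sin_neg, mul_neg, intervalIntegral.integral_neg]
      exact ⟨hc, by rw [hs, neg_zero]⟩
  have hcoeff : fourierCoeff f = 0 := by
    funext n
    rw [fourierCoeff_eq_intervalIntegral _ n 0, zero_add]
    have e : ∀ θ : ℝ, fourier (-n) (θ : AddCircle (2 * Real.pi)) • f (θ : AddCircle (2 * Real.pi))
        = ((w (r • dir θ) * Real.cos ((-n : ℤ) * θ) : ℝ) : ℂ)
          + ((w (r • dir θ) * Real.sin ((-n : ℤ) * θ) : ℝ) : ℂ) * Complex.I := by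
      intro θ
      have e1 : 2 * (Real.pi : ℂ) * Complex.I * ((-n : ℤ) : ℂ) * θ / ((2 * Real.pi : ℝ) : ℂ)
          = (((-n : ℤ) * θ : ℝ) : ℂ) * Complex.I := by
        have : (Real.pi : ℂ) ≠ 0 := by exact_mod_cast Real.pi_ne_zero
        push_cast
        field_simp
      rw [hf, fourier_coe_apply, e1, Complex.exp_mul_I, ← Complex.ofReal_cos, ← Complex.ofReal_sin,
        smul_eq_mul, Complex.ofReal_mul, Complex.ofReal_mul]
      ring
    simp_rw [e]
    rw [intervalIntegral.integral_add (Continuous.intervalIntegrable (by fun_prop) _ _)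
      (Continuous.intervalIntegrable (by fun_prop) _ _), intervalIntegral.integral_mul_const,
      intervalIntegral.integral_ofReal, intervalIntegral.integral_ofReal, (hint (-n)).1,
      (hint (-n)).2]
    simp
  -- Zero coefficients are trivially summable, so the Fourier series converges to f; its sum is 0.
  have hsum := hasSum_fourier_series_of_summable (f := f) (by rw [hcoeff]; exact summable_zero)
  rw [hcoeff] at hsum
  have hf0 : f = 0 := by
    refine hsum.unique ?_
    simp
  have := hf θ₀
  rw [hf0, ContinuousMap.zero_apply, ← hx] at this
  exact_mod_cast this.symm

/-! ### Uniqueness for the scalar equations -/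

theorem hasDerivAt_eight_add_sq (r : ℝ) : HasDerivAt (fun r : ℝ => 8 + r ^ 2) (2 * r) r := by
  simpa using (hasDerivAt_pow 2 r).const_add 8

theorem isRadialSolution_zero : IsRadialSolution (modeCoeff (-1) 0)
    (fun r => (8 - r ^ 2) / (8 + r ^ 2)) (fun r => -32 * r / (8 + r ^ 2) ^ 2) where
  hasDerivAt r := by
    have h8 : 8 + r ^ 2 ≠ 0 := by positivity
    convert! ((hasDerivAt_pow 2 r).const_sub 8).div (hasDerivAt_eight_add_sq r) h8 using 1
    simp
    ring
  continuous_deriv := by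
    have : ∀ r : ℝ, (8 + r ^ 2) ^ 2 ≠ 0 := fun r => by positivity
    fun_prop (disch := assumption)
  ode r hr := by
    have h8 : 8 + r ^ 2 ≠ 0 := by positivity
    convert! (hasDerivAt_id r).mul (((hasDerivAt_id r).const_mul (-32)).div
      ((hasDerivAt_eight_add_sq r).pow 2) (pow_ne_zero 2 h8)) using 1
    simp [modeCoeff]
    field_simp
    ring

theorem isRadialSolution_one : IsRadialSolution (modeCoeff (-1) 1)
    (fun r => r / (8 + r ^ 2)) (fun r => (8 - r ^ 2) / (8 + r ^ 2) ^ 2) where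
  hasDerivAt r := by
    have h8 : 8 + r ^ 2 ≠ 0 := by positivity
    convert! (hasDerivAt_id r).div (hasDerivAt_eight_add_sq r) h8 using 1
    simp
    ring
  continuous_deriv := by
    have : ∀ r : ℝ, (8 + r ^ 2) ^ 2 ≠ 0 := fun r => by positivity
    fun_prop (disch := assumption)
  ode r hr := by
    have h8 : 8 + r ^ 2 ≠ 0 := by positivity
    convert! (hasDerivAt_id r).mul (((hasDerivAt_pow 2 r).const_sub 8).div
      ((hasDerivAt_eight_add_sq r).pow 2) (pow_ne_zero 2 h8)) using 1
    simp [modeCoeff]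
    field_simp
    ring

/-- The explicit solution vanishes at √8, so (0, √8) and (√8, ∞) are treated separately. The datum
m'(√8) = 0 passes across, the explicit derivative being nonzero there. -/
theorem eq_zero_of_isRadialSolution_zero {m m' : ℝ → ℝ}
    (hm : IsRadialSolution (modeCoeff (-1) 0) m m') (h0 : m 0 = 0) {r : ℝ} (hr : 0 ≤ r) :
    m r = 0 := by
  have h8 : (0 : ℝ) < √8 := by positivity
  have hsq : √8 ^ 2 = (8 : ℝ) := Real.sq_sqrt (by norm_num)
  have h1 := hm.eq_zero_on_closure isRadialSolution_zero (S := Set.Ioo 0 √8) isOpen_Ioo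
    isPreconnected_Ioo (fun r hr => hr.1) (fun r hr => by
      have : r ^ 2 < 8 := by rw [← hsq]; exact pow_lt_pow_left₀ hr.2 hr.1.le two_ne_zero
      have h : 0 < 8 - r ^ 2 := by linarith
      positivity) (r₀ := 0) (by rw [closure_Ioo h8.ne]; exact ⟨le_rfl, h8.le⟩)
      (Or.inl ⟨h0, by norm_num⟩)
  rw [closure_Ioo h8.ne] at h1
  have h2 := hm.eq_zero_on_closure isRadialSolution_zero (S := Set.Ioi √8) isOpen_Ioi
    isPreconnected_Ioi (fun r hr => h8.trans hr) (fun r hr => by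
      have : 8 < r ^ 2 := by rw [← hsq]; exact pow_lt_pow_left₀ hr h8.le two_ne_zero
      exact div_ne_zero (by linarith) (by positivity)) (r₀ := √8)
      (by rw [closure_Ioi]; exact Set.self_mem_Ici)
      (Or.inr ⟨(h1 √8 ⟨h8.le, le_rfl⟩).2, div_ne_zero (by simp) (by positivity)⟩)
  rw [closure_Ioi] at h2
  rcases le_total r √8 with h | h
  · exact (h1 r ⟨hr, h⟩).1
  · exact (h2 r h).1

theorem eq_zero_of_isRadialSolution_one {m m' : ℝ → ℝ}
    (hm : IsRadialSolution (modeCoeff (-1) 1) m m') (h0 : m' 0 = 0) {r : ℝ} (hr : 0 ≤ r) :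
    m r = 0 := by
  have h1 := hm.eq_zero_on_closure isRadialSolution_one (S := Set.Ioi 0) isOpen_Ioi
    isPreconnected_Ioi subset_rfl (fun r hr => by
      have : 0 < r := hr
      positivity) (r₀ := 0) (by rw [closure_Ioi]; exact Set.self_mem_Ici)
      (Or.inr ⟨h0, by norm_num⟩)
  rw [closure_Ioi] at h1
  exact (h1 r hr).1

/-- The potential 64 r² / (8 + r²)² is at most 2, attained at r² = 8, while k² ≥ 4. -/
theorem one_le_modeCoeff_neg_one {k r : ℝ} (hk : 2 ≤ k) : 1 ≤ modeCoeff (-1) k r := by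
  have h : 64 * r ^ 2 / (8 + r ^ 2) ^ 2 ≤ 2 := by
    rw [div_le_iff₀ (by positivity)]
    nlinarith [sq_nonneg (8 - r ^ 2)]
  rw [modeCoeff]
  nlinarith

theorem one_le_modeCoeff_one {k r : ℝ} (hk : 1 ≤ k) : 1 ≤ modeCoeff 1 k r := by
  have h : 0 ≤ 64 * r ^ 2 / (8 + r ^ 2) ^ 2 := by positivity
  rw [modeCoeff]
  nlinarith

theorem IsScalarSolution.eq_zero_of_neg_one {w : Plane → ℝ} (hw : IsScalarSolution (-1) w)
    (h0 : w 0 = 0) (h1 : fderiv ℝ w 0 = 0) {C τ : ℝ} (hτ : τ < 1)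
    (hg : ∀ x, |w x| ≤ C * (1 + ‖x‖) ^ τ) (x : Plane) : w x = 0 := by
  have key : ∀ (k : ℕ) (χ χ' : ℝ → ℝ), IsAngularMode k χ χ' → ∀ r, 0 ≤ r → mode w χ r = 0 := by
    intro k χ χ' hχ r hr
    have hm := hw.isRadialSolution hχ
    rcases k with _ | _ | k
    · rw [Nat.cast_zero] at hm
      exact eq_zero_of_isRadialSolution_zero hm (mode_zero_of_eq_zero h0 χ) hr
    · rw [zero_add, Nat.cast_one] at hm
      exact eq_zero_of_isRadialSolution_one hm (modeDeriv_zero_of_fderiv_eq_zero h1 χ) hr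
    · refine hm.eq_zero_of_growth (fun r _ => one_le_modeCoeff_neg_one ?_)
        (mode_zero_of_eq_zero h0 χ) hτ (fun r hr => abs_mode_le hχ hg hr) r hr
      push_cast
      linarith [(k.cast_nonneg : (0 : ℝ) ≤ k)]
  exact eq_zero_of_modes_eq_zero hw.contDiff.continuous
    (fun k => key k _ _ (isAngularMode_cos k)) (fun k => key k _ _ (isAngularMode_sin k)) x

theorem isScalarSolution_phi3 : IsScalarSolution 1 phi3 :=
  ⟨contDiff_two_phi3, fun x => by rw [laplacian_phi3, one_mul]⟩

theorem IsScalarSolution.eq_zero_of_one {w : Plane → ℝ} (hw : IsScalarSolution 1 w)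
    (h0 : w 0 = 0) {C τ : ℝ} (hτ : τ < 1)
    (hg : ∀ x, |w x| ≤ C * (1 + ‖x‖) ^ τ) (x : Plane) : w x = 0 := by
  have key : ∀ (k : ℕ) (χ χ' : ℝ → ℝ), IsAngularMode k χ χ' → ∀ r, 0 ≤ r → mode w χ r = 0 := by
    intro k χ χ' hχ r hr
    have hm := hw.isRadialSolution hχ
    rcases k with _ | k
    · have hp := isScalarSolution_phi3.isRadialSolution (isAngularMode_cos 0)
      have hpos : ∀ r, 0 < mode phi3 (fun θ => Real.cos ((0 : ℕ) * θ)) r := by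
        intro r
        have hdir := continuous_dir
        have hc := contDiff_two_phi3.continuous
        refine intervalIntegral.intervalIntegral_pos_of_pos
          (Continuous.intervalIntegrable (by fun_prop) _ _) (fun θ => ?_) Real.two_pi_pos
        simpa using phi3_pos _
      have h := hm.eq_zero_on_closure hp (S := Set.Ioi 0) isOpen_Ioi isPreconnected_Ioi subset_rfl
        (fun r _ => (hpos r).ne') (r₀ := 0) (by rw [closure_Ioi]; exact Set.self_mem_Ici)
        (Or.inl ⟨mode_zero_of_eq_zero h0 χ, (hpos 0).ne'⟩)
      rw [closure_Ioi] at h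
      exact (h r hr).1
    · refine hm.eq_zero_of_growth (fun r _ => one_le_modeCoeff_one ?_)
        (mode_zero_of_eq_zero h0 χ) hτ (fun r hr => abs_mode_le hχ hg hr) r hr
      push_cast
      linarith [(k.cast_nonneg : (0 : ℝ) ≤ k)]
  exact eq_zero_of_modes_eq_zero hw.contDiff.continuous
    (fun k => key k _ _ (isAngularMode_cos k)) (fun k => key k _ _ (isAngularMode_sin k)) x

/-! ### The linearized system -/

theorem IsLinearizedSolution.add_isScalarSolution {τ : ℝ} {u v : Plane → ℝ}
    (h : IsLinearizedSolution τ u v) : IsScalarSolution (-1) (u + v) := by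
  refine ⟨h.contDiff_left.add h.contDiff_right, fun x => ?_⟩
  have h1 := h.eq_left x
  have h2 := h.eq_right x
  rw [exp_bubble] at h1 h2
  rw [h.contDiff_left.contDiffAt.laplacian_add h.contDiff_right.contDiffAt, Pi.add_apply]
  linarith

theorem IsLinearizedSolution.sub_isScalarSolution {τ : ℝ} {u v : Plane → ℝ}
    (h : IsLinearizedSolution τ u v) : IsScalarSolution 1 (u - v) := by
  refine ⟨h.contDiff_left.sub h.contDiff_right, fun x => ?_⟩
  have h1 := h.eq_left x
  have h2 := h.eq_right x
  rw [exp_bubble] at h1 h2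
  rw [h.contDiff_left.contDiffAt.laplacian_sub h.contDiff_right.contDiffAt, Pi.sub_apply]
  linarith

theorem IsScalarSolution.isLinearizedSolution_diag {τ : ℝ} {w : Plane → ℝ}
    (hw : IsScalarSolution (-1) w) (hg : ∃ C : ℝ, ∀ x, |w x| ≤ C * (1 + ‖x‖) ^ τ) :
    IsLinearizedSolution τ w w := by
  have h : ∀ x, -(Δ w) x = Real.exp (bubble x) * w x := fun x => by
    rw [hw.eq, exp_bubble]; ring
  obtain ⟨C, hC⟩ := hg
  exact ⟨hw.contDiff, hw.contDiff, h, h, C, fun x => ⟨hC x, hC x⟩⟩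

theorem IsScalarSolution.isLinearizedSolution_antidiag {τ : ℝ} {w : Plane → ℝ}
    (hw : IsScalarSolution 1 w) (hg : ∃ C : ℝ, ∀ x, |w x| ≤ C * (1 + ‖x‖) ^ τ) :
    IsLinearizedSolution τ w (-w) := by
  obtain ⟨C, hC⟩ := hg
  refine ⟨hw.contDiff, hw.contDiff.neg, fun x => ?_, fun x => ?_, C, fun x => ⟨hC x, ?_⟩⟩
  · rw [hw.eq, exp_bubble, Pi.neg_apply]; ring
  · rw [InnerProductSpace.laplacian_neg, Pi.neg_apply, hw.eq, exp_bubble]; ring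
  · rw [Pi.neg_apply, abs_neg]; exact hC x

theorem IsLinearizedSolution.mono {τ τ' : ℝ} {u v : Plane → ℝ} (h : IsLinearizedSolution τ u v)
    (hτ : τ ≤ τ') : IsLinearizedSolution τ' u v := by
  obtain ⟨C, hC⟩ := h.growth
  have hC0 : 0 ≤ C := by simpa using (abs_nonneg _).trans (hC 0).1
  have hle : ∀ x : Plane, C * (1 + ‖x‖) ^ τ ≤ C * (1 + ‖x‖) ^ τ' := fun x => by
    have : 1 ≤ 1 + ‖x‖ := by linarith [norm_nonneg x]
    gcongr
  exact ⟨h.contDiff_left, h.contDiff_right, h.eq_left, h.eq_right, C,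
    fun x => ⟨(hC x).1.trans (hle x), (hC x).2.trans (hle x)⟩⟩

theorem exists_growth_of_abs_le_one {τ : ℝ} (hτ : 0 ≤ τ) {w : Plane → ℝ} (h : ∀ x, |w x| ≤ 1) :
    ∃ C : ℝ, ∀ x, |w x| ≤ C * (1 + ‖x‖) ^ τ :=
  ⟨1, fun x => by
    rw [one_mul]
    exact (h x).trans (Real.one_le_rpow (by linarith [norm_nonneg x]) hτ)⟩

theorem abs_phi0_le (x : Plane) : |phi0 x| ≤ 1 := by
  have h := sq_nonneg ‖x‖
  rw [phi0, abs_div, abs_of_pos (by positivity : 0 < 8 + ‖x‖ ^ 2), div_le_one (by positivity),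
    abs_le]
  constructor <;> linarith

theorem abs_coord_div_le (i : Fin 2) (x : Plane) : |x i / (8 + ‖x‖ ^ 2)| ≤ 1 := by
  have h := PiLp.norm_apply_le x i
  rw [Real.norm_eq_abs] at h
  rw [abs_div, abs_of_pos (by positivity : 0 < 8 + ‖x‖ ^ 2), div_le_one (by positivity)]
  nlinarith [sq_nonneg (‖x‖ - 1)]

theorem exists_growth_phi3 {τ : ℝ} (hτ : 0 < τ) :
    ∃ C : ℝ, ∀ x, |phi3 x| ≤ C * (1 + ‖x‖) ^ τ := by
  obtain ⟨K, hK⟩ := exists_phi3_sub_log_bound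
  refine ⟨K + logCoeff * (2 / τ), fun x => ?_⟩
  have hL := logCoeff_pos
  have hK0 : 0 ≤ K := (abs_nonneg _).trans (hK 0)
  have h1 : 1 ≤ 1 + ‖x‖ := by linarith [norm_nonneg x]
  have hr : 1 ≤ (1 + ‖x‖) ^ τ := Real.one_le_rpow h1 hτ.le
  have hlog : Real.log (1 + 1 / 8 * ‖x‖ ^ 2) ≤ 2 * ((1 + ‖x‖) ^ τ / τ) := by
    calc Real.log (1 + 1 / 8 * ‖x‖ ^ 2) ≤ Real.log ((1 + ‖x‖) ^ 2) := by
          refine Real.log_le_log (by positivity) ?_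
          nlinarith [norm_nonneg x]
      _ = 2 * Real.log (1 + ‖x‖) := by rw [Real.log_pow]; norm_num
      _ ≤ _ := by
          gcongr
          exact Real.log_le_rpow_div (by positivity) hτ
  have h2 := (abs_le.1 (hK x)).2
  rw [abs_of_pos (phi3_pos x)]
  calc phi3 x ≤ K * 1 + logCoeff * Real.log (1 + 1 / 8 * ‖x‖ ^ 2) := by linarith
    _ ≤ K * (1 + ‖x‖) ^ τ + logCoeff * (2 * ((1 + ‖x‖) ^ τ / τ)) := by gcongr
    _ = _ := by ring

theorem basisPair_mem {τ : ℝ} (hτ : 0 < τ) (i : Fin 4) :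
    basisPair phi3 i ∈ solutionSpace τ := by
  fin_cases i
  · exact IsScalarSolution.isLinearizedSolution_diag ⟨contDiff_phi0, fun x => by
      rw [neg_one_mul]; exact laplacian_phi0 x⟩
      (exists_growth_of_abs_le_one hτ.le abs_phi0_le)
  · exact IsScalarSolution.isLinearizedSolution_diag ⟨contDiff_phi1, fun x => by
      rw [neg_one_mul]; exact laplacian_coord_div 0 x⟩
      (exists_growth_of_abs_le_one hτ.le (abs_coord_div_le 0))
  · exact IsScalarSolution.isLinearizedSolution_diag ⟨contDiff_phi2, fun x => by
      rw [neg_one_mul]; exact laplacian_coord_div 1 x⟩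
      (exists_growth_of_abs_le_one hτ.le (abs_coord_div_le 1))
  · exact isScalarSolution_phi3.isLinearizedSolution_antidiag (exists_growth_phi3 hτ)

/-! ### Matching data at the origin and the classification -/

theorem hasFDerivAt_norm_sq_zero : HasFDerivAt (fun x : Plane => ‖x‖ ^ 2) (0 : Plane →L[ℝ] ℝ) 0 := by
  simpa using (hasStrictFDerivAt_norm_sq (0 : Plane)).hasFDerivAt

theorem hasFDerivAt_phi0_zero : HasFDerivAt phi0 (0 : Plane →L[ℝ] ℝ) 0 := by
  have h := ((hasDerivAt_inv_eight_add (s := ‖(0 : Plane)‖ ^ 2) (by positivity)).comp_hasFDerivAt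
    (0 : Plane) hasFDerivAt_norm_sq_zero).const_mul 16 |>.sub_const 1
  simp only [smul_zero] at h
  refine h.congr_of_eventuallyEq (Eventually.of_forall fun x => ?_)
  have : 8 + ‖x‖ ^ 2 ≠ 0 := by positivity
  simp [phi0]
  field_simp
  ring

theorem hasFDerivAt_coord_div_zero (i : Fin 2) :
    HasFDerivAt (fun x : Plane => x i / (8 + ‖x‖ ^ 2))
      ((1 / 8 : ℝ) • (EuclideanSpace.proj i : Plane →L[ℝ] ℝ)) 0 := by
  have h := (EuclideanSpace.proj (𝕜 := ℝ) i).hasFDerivAt (x := (0 : Plane)) |>.mul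
    ((hasDerivAt_inv_eight_add (s := ‖(0 : Plane)‖ ^ 2) (by positivity)).comp_hasFDerivAt
    (0 : Plane) hasFDerivAt_norm_sq_zero)
  convert! h using 1
  simp

theorem exists_eq_sum_basisPair {τ : ℝ} (hτ0 : 0 ≤ τ) (hτ1 : τ < 1) {u v : Plane → ℝ}
    (h : IsLinearizedSolution τ u v) : ∃ c : Fin 4 → ℝ, (u, v) = ∑ i, c i • basisPair phi3 i := by
  -- φ₃ grows logarithmically, so a positive exponent is needed even when τ = 0; τ' remains below 1.
  set τ' := (τ + 1) / 2 with hτ'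
  have hτ'0 : 0 < τ' := by positivity
  have hτ'1 : τ' < 1 := by rw [hτ']; linarith
  set D := fderiv ℝ (u + v) 0 with hD
  -- The pairs contribute 2 c_i φ_i to u + v and 2 c₃ φ₃ to u - v. Since φ₀(0) = φ₃(0) = 1 and
  -- ∇φ_i(0) = e_i / 8 for i = 1, 2, matching the data gives the factors 1/2 and 4.
  let c : Fin 4 → ℝ := ![(u 0 + v 0) / 2, 4 * D (EuclideanSpace.single 0 1),
    4 * D (EuclideanSpace.single 1 1), (u 0 - v 0) / 2]
  refine ⟨c, ?_⟩
  have hmem : (u, v) - ∑ i, c i • basisPair phi3 i ∈ solutionSpace τ' :=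
    Submodule.sub_mem _ (h.mono (by rw [hτ']; linarith))
      (Submodule.sum_mem _ fun i _ => Submodule.smul_mem _ _ (basisPair_mem hτ'0 i))
  set p := (u, v) - ∑ i, c i • basisPair phi3 i with hp
  have hsol : IsLinearizedSolution τ' p.1 p.2 := hmem
  obtain ⟨C, hC⟩ := hsol.growth
  have hadd : p.1 + p.2 = fun x => (u + v) x - 2 * (c 0 * phi0 x + c 1 * (x 0 / (8 + ‖x‖ ^ 2))
      + c 2 * (x 1 / (8 + ‖x‖ ^ 2))) := by
    funext x
    simp [hp, Fin.sum_univ_four, basisPair, phi1, phi2]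
    ring
  have hsub : p.1 - p.2 = fun x => (u x - v x) - 2 * (c 3 * phi3 x) := by
    funext x
    simp [hp, Fin.sum_univ_four, basisPair, phi1, phi2]
    ring
  have hfd : fderiv ℝ (p.1 + p.2) 0 = 0 := by
    have huv : HasFDerivAt (u + v) D 0 :=
      ((h.contDiff_left.add h.contDiff_right).differentiable (by norm_num) 0).hasFDerivAt
    rw [hadd]
    refine HasFDerivAt.fderiv ?_
    convert! huv.sub ((((hasFDerivAt_phi0_zero.const_mul (c 0)).add
      ((hasFDerivAt_coord_div_zero 0).const_mul (c 1))).add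
      ((hasFDerivAt_coord_div_zero 1).const_mul (c 2))).const_mul 2) using 1
    ext x
    have : x = x 0 • EuclideanSpace.single 0 1 + x 1 • EuclideanSpace.single 1 1 := by
      ext i; fin_cases i <;> simp
    have hx : D x = x 0 * D (EuclideanSpace.single 0 1) + x 1 * D (EuclideanSpace.single 1 1) := by
      conv_lhs => rw [this]
      simp
    simp [hx, c]
    ring
  have habs : ∀ x, |p.1 x| + |p.2 x| ≤ 2 * C * (1 + ‖x‖) ^ τ' := fun x => by
    linarith [(hC x).1, (hC x).2]
  have hz1 : ∀ x, (p.1 + p.2) x = 0 :=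
    hsol.add_isScalarSolution.eq_zero_of_neg_one (by rw [hadd]; simp [phi0, c]; ring) hfd hτ'1
      (C := 2 * C) fun x => (abs_add_le _ _).trans (habs x)
  have hz2 : ∀ x, (p.1 - p.2) x = 0 :=
    hsol.sub_isScalarSolution.eq_zero_of_one (by rw [hsub]; simp [phi3_zero, c]; ring) hτ'1
      (C := 2 * C) fun x => (abs_sub _ _).trans (habs x)
  refine sub_eq_zero.1 (Prod.ext (funext fun x => ?_) (funext fun x => ?_))
  · have h1 := hz1 x
    have h2 := hz2 x
    simp only [Pi.add_apply, Pi.sub_apply] at h1 h2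
    change p.1 x = 0
    linarith
  · have h1 := hz1 x
    have h2 := hz2 x
    simp only [Pi.add_apply, Pi.sub_apply] at h1 h2
    change p.2 x = 0
    linarith

/-- Comparing the two components at 0 isolates c₃, then φ₁(0) = φ₂(0) = 0 isolates c₀, and the unit
vectors isolate c₁ and c₂. -/
theorem linearIndependent_basisPair : LinearIndependent ℝ (basisPair phi3) := by
  rw [Fintype.linearIndependent_iff]
  intro c hc
  have h1 : ∀ x, c 0 * phi0 x + c 1 * phi1 x + c 2 * phi2 x + c 3 * phi3 x = 0 := fun x => by
    have := congrFun (congrArg Prod.fst hc) x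
    simpa [Fin.sum_univ_four, basisPair] using this
  have h2 : ∀ x, c 0 * phi0 x + c 1 * phi1 x + c 2 * phi2 x - c 3 * phi3 x = 0 := fun x => by
    have := congrFun (congrArg Prod.snd hc) x
    simpa [Fin.sum_univ_four, basisPair, sub_eq_add_neg] using this
  have e3 : c 3 = 0 := by
    have a := h1 0
    have b := h2 0
    rw [phi3_zero] at a b
    linarith
  have e0 : c 0 = 0 := by
    have a := h1 0
    simpa [phi0, phi1, phi2, e3] using a
  have e1 : c 1 = 0 := by
    have a := h1 (EuclideanSpace.single 0 1)
    simpa [phi1, phi2, e3, e0, show (8 + 1 : ℝ) ≠ 0 by norm_num] using a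
  have e2 : c 2 = 0 := by
    have a := h1 (EuclideanSpace.single 1 1)
    simpa [phi1, phi2, e3, e0, show (8 + 1 : ℝ) ≠ 0 by norm_num] using a
  intro i
  fin_cases i
  exacts [e0, e1, e2, e3]

theorem solutionSpace_eq_span {τ : ℝ} (hτ0 : 0 < τ) (hτ1 : τ < 1) :
    solutionSpace τ = Submodule.span ℝ (Set.range (basisPair phi3)) := by
  refine le_antisymm ?_ (Submodule.span_le.2 ?_)
  · rintro ⟨u, v⟩ h
    obtain ⟨c, hc⟩ := exists_eq_sum_basisPair hτ0.le hτ1 h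
    rw [hc]
    exact Submodule.sum_mem _ fun i _ =>
      Submodule.smul_mem _ _ (Submodule.subset_span (Set.mem_range_self i))
  · rintro _ ⟨i, rfl⟩
    exact basisPair_mem hτ0 i

end LaneEmden

end

theorem lemma2p1 :
    ∃ phi3 : LaneEmden.Plane → ℝ,
      -- the hypergeometric formula for `φ₃`
      (∀ x, (phi3 x : ℂ) = ordinaryHypergeometric LaneEmden.hyperParam
        (1 - LaneEmden.hyperParam) (1 : ℂ) ((‖x‖ ^ 2 / (8 + ‖x‖ ^ 2) : ℝ) : ℂ)) ∧
      -- `φ₃` is a smooth positive radial solution of `-Δ φ + e ^ U φ = 0` with `φ₃(0) = 1`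
      ContDiff ℝ ∞ phi3 ∧
      (∀ x, 0 < phi3 x) ∧
      (∀ x y, ‖x‖ = ‖y‖ → phi3 x = phi3 y) ∧
      phi3 0 = 1 ∧
      (∀ x, -(Δ phi3) x + Real.exp (LaneEmden.bubble x) * phi3 x = 0) ∧
      -- asymptotics of `φ₃` and of its gradient as `|x| → ∞`
      (fun x => phi3 x - LaneEmden.logCoeff * Real.log (1 + (1 / 8) * ‖x‖ ^ 2))
        =O[cocompact LaneEmden.Plane] (fun _ => (1 : ℝ)) ∧
      (fun x => ∇ phi3 x - (2 * LaneEmden.logCoeff / ‖x‖ ^ 2) • x)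
        =o[cocompact LaneEmden.Plane] (fun x => 1 / ‖x‖) ∧
      -- every solution with growth exponent `τ ∈ [0, 1)` is a combination of the four pairs
      (∀ τ : ℝ, 0 ≤ τ → τ < 1 → ∀ u v : LaneEmden.Plane → ℝ,
        LaneEmden.IsLinearizedSolution τ u v →
        ∃ c : Fin 4 → ℝ, (u, v) = ∑ i, c i • LaneEmden.basisPair phi3 i) ∧
      -- for `τ ∈ (0, 1)` the four pairs form a basis of the solution space, of dimension four
      LinearIndependent ℝ (LaneEmden.basisPair phi3) ∧
      (∀ τ : ℝ, 0 < τ → τ < 1 →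
        LaneEmden.solutionSpace τ = Submodule.span ℝ (Set.range (LaneEmden.basisPair phi3)) ∧
        Module.finrank ℝ (LaneEmden.solutionSpace τ) = 4) := by
  refine ⟨LaneEmden.phi3, fun x => (LaneEmden.ordinaryHypergeometric_hyperParam _).symm,
    LaneEmden.contDiff_phi3, LaneEmden.phi3_pos,
    fun x y h => by rw [LaneEmden.phi3, LaneEmden.phi3, h], LaneEmden.phi3_zero, fun x => ?_, ?_,
    LaneEmden.isLittleO_gradient_phi3, fun τ h0 h1 u v h => LaneEmden.exists_eq_sum_basisPair h0 h1 h,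
    LaneEmden.linearIndependent_basisPair, fun τ h0 h1 => ?_⟩
  · rw [LaneEmden.laplacian_phi3, LaneEmden.exp_bubble]
    ring
  · obtain ⟨K, hK⟩ := LaneEmden.exists_phi3_sub_log_bound
    exact IsBigO.of_bound K (Eventually.of_forall fun x => by simpa using hK x)
  · have h := LaneEmden.solutionSpace_eq_span h0 h1
    refine ⟨h, ?_⟩
    rw [h, finrank_span_eq_card LaneEmden.linearIndependent_basisPair, Fintype.card_fin]
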